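/- A bidirected graph $B=(G,\sigma)$ is a loopless multigraph $G=(V,E)$ together with a sign $\sigma(e,u)\in\{+,-\}$ for every edge $e$ and each endpoint $u$ of $e$. An orientation of an edge $e$ with endpoints $u,v$ is a triple $\vec e=(e,u,v)$, with tail $u$ and head $v$ (so every edge has exactly two orientations). A trail is a sequence $v_0\vec e_1v_1\vec e_2\dots\vec e_\ell v_\ell$ $(\ell\ge 0)$ of vertices and oriented edges such that $\vec e_i$ has tail $v_{i-1}$ and head $v_i$, the edges $e_1,\dots,e_\ell$ are pairwise distinct, and $\sigma(e_{i+1},v_i)=-\sigma(e_i,v_i)$ for $1\le i<\ell$. It is an $x$–$y$ trail if $v_0=x$ and $v_\ell=y$. Two trails are edge-disjoint if no edge has an orientation in both of them. Fix a root $r\in V$. An $r$-trail is a trail with $v_0=r$ and $v_i\ne r$ for $0<i<\ell$; an $r$–$\vec e$ trail is an $r$-trail with last edge $\vec e_\ell=\vec e$. Call $B$ edge-clean if for every edge $e$ incident with $r$ there is exactly one orientation $\vec e$ of $e$ for which an $r$–$\vec e$ trail exists. For $X\subseteq V\setminus\{r\}$ let $\delta^{\mathsf{trail}}_{r,B}(X)$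 be the set of edges $e$ that have an orientation $\vec e$ with head in $X$ and tail not in $X$ such that an $r$–$\vec e$ trail exists. **Theorem.** Let $B$ be an edge-clean bidirected graph rooted at $r$ and let $x\in V\setminus\{r\}$. Then the maximum number $\lambda^{\mathrm{trail}}_B(r,x)$ of pairwise edge-disjoint $r$–$x$ trails satisfies $$\lambda^{\mathrm{trail}}_B(r,x)=\min\bigl\{\,|\delta^{\mathsf{trail}}_{r,B}(X)| : x\in X\subseteq V\setminus\{r\}\,\bigr\}.$$ ($B$ may be infinite; numbers of trails and edges are counted in $\mathbb N\cup\{\infty\}$, and both the maximum and the minimum are attained.) -/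

import Mathlib

/-- A bidirected graph: a loopless multigraph (with vertices in `α` and edges in `β`) together
with a sign in `{+1, -1} = ℤˣ` for every half-edge `(e, u)`, `u` an endpoint of `e`. -/
structure BidirectedGraph (α β : Type*) where
  graph : Graph α β
  loopless : graph.Loopless
  sign : {h : β × α // graph.Inc h.1 h.2} → ℤˣ

namespace BidirectedGraph

variable {α β : Type*}

/-- An oriented edge `(e, u, v)`: an edge with its two endpoints in a chosen order. -/
@[ext]
structure OrientedEdge (B : BidirectedGraph α β) where
  edge : β
  tail : α
  head : α
  isLink : B.graph.IsLink edge tail head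

namespace OrientedEdge

variable {B : BidirectedGraph α β}

/-- The sign of the underlying edge at the tail. -/
def tailSign (e : B.OrientedEdge) : ℤˣ :=
  B.sign ⟨(e.edge, e.tail), e.isLink.inc_left⟩

/-- The sign of the underlying edge at the head. -/
def headSign (e : B.OrientedEdge) : ℤˣ :=
  B.sign ⟨(e.edge, e.head), e.isLink.inc_right⟩

end OrientedEdge

/-- A trail `v₀ e₁ v₁ … e_ℓ v_ℓ`, given by `v₀` and the list of oriented edges `e₁, …, e_ℓ`;
the further vertices are the heads `v_i` of the `e_i`. The underlying edges are distinct, and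
at each internal vertex the two consecutive edges have opposite signs. -/
@[ext]
structure Trail (B : BidirectedGraph α β) where
  init : α
  init_mem : init ∈ B.graph.vertexSet
  edges : List B.OrientedEdge
  tail_first : ∀ e ∈ edges.head?, e.tail = init
  chain : edges.IsChain fun e f => f.tail = e.head ∧ f.tailSign = -e.headSign
  nodup : (edges.map OrientedEdge.edge).Nodup

namespace Trail

variable {B : BidirectedGraph α β}

/-- The terminal vertex `v_ℓ`. -/
def term (T : B.Trail) : α :=
  (T.edges.getLast?.map OrientedEdge.head).getD T.init

/-- `E(T)`: the edges that have an orientation appearing in `T`. -/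
def edgeSet (T : B.Trail) : Set β :=
  {e | ∃ o ∈ T.edges, o.edge = e}

/-- An `x`–`y` trail. -/
def IsFromTo (T : B.Trail) (x y : α) : Prop :=
  T.init = x ∧ T.term = y

/-- An `r`-trail: it starts in `r` and none of its internal vertices `v₁, …, v_{ℓ-1}` is `r`. -/
def IsRooted (T : B.Trail) (r : α) : Prop :=
  T.init = r ∧ ∀ e ∈ T.edges.dropLast, e.head ≠ r

end Trail

/-- There is an `r`-trail whose terminal edge is the oriented edge `o`. -/
def TrailReaches (B : BidirectedGraph α β) (r : α) (o : B.OrientedEdge) : Prop :=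
  ∃ T : B.Trail, T.IsRooted r ∧ T.edges.getLast? = some o

/-- The edge `e` has exactly one orientation that is the terminal edge of some `r`-trail. -/
def IsTrailDirectable (B : BidirectedGraph α β) (r : α) (e : β) : Prop :=
  ∃! o : B.OrientedEdge, o.edge = e ∧ B.TrailReaches r o

/-- Every edge incident with the root is trail-directable. -/
def EdgeClean (B : BidirectedGraph α β) (r : α) : Prop :=
  ∀ e, B.graph.Inc e r → B.IsTrailDirectable r e

/-- `δ^trail_{r,B}(X)`: the edges having an orientation with head in `X` and tail outside `X`
that is the terminal edge of some `r`-trail. -/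
def trailCut (B : BidirectedGraph α β) (r : α) (X : Set α) : Set β :=
  {e | ∃ o : B.OrientedEdge, o.edge = e ∧ o.head ∈ X ∧ o.tail ∉ X ∧ B.TrailReaches r o}

/-- A set of pairwise edge-disjoint `x`–`y` trails. -/
def IsEdgeDisjointTrails (B : BidirectedGraph α β) (x y : α) (𝒯 : Set B.Trail) : Prop :=
  (∀ T ∈ 𝒯, T.IsFromTo x y) ∧ 𝒯.Pairwise fun S T => Disjoint S.edgeSet T.edgeSet

end BidirectedGraph

/-!
A trail of a bidirected graph is a walk, with every edge used at most once, in a skew-symmetric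
digraph: its states are the vertices with a sign, and reversing an edge reverses an arc up to
opposite signs. If `B` is edge-clean, then no such trail returns to the root. If not even a walk
returns to the root, then the arcs on walks from the root use every edge in one direction only, and
the edge version of Menger's theorem for digraphs applies. Otherwise a shortest closed walk at the
root is a stem with a cycle at its end, and the cycle is a blossom: after the last arc of the stem,
every vertex on it can be reached with either sign. Contracting blossoms until no closed walk at the
root is left yields a digraph in which every contracted set is entered by a single arc. Hence
disjoint walks pass through disjoint contracted sets and lift to edge-disjoint trails, and a minimum
cut of this digraph is a trail cut.

For infinite `B`, the cuts obtained for the finite sets of edges converge along an ultrafilter, and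
a maximal set of edge-disjoint trails is infinite if there are arbitrarily large finite ones.
-/

/-! ### Edge-disjoint walks in directed multigraphs -/

theorem exists_eq_append_of_not_pairwise {α : Type*} {R : α → α → Prop} {l : List α}
    (h : ¬ l.Pairwise R) :
    ∃ l₁ a l₂ b l₃, l = l₁ ++ a :: (l₂ ++ b :: l₃) ∧ ¬ R a b := by
  induction l with
  | nil => exact absurd List.Pairwise.nil h
  | cons a l ih =>
    rw [List.pairwise_cons, not_and_or] at h
    rcases h with ha | hl
    · push Not at ha
      obtain ⟨b, hb, hab⟩ := ha
      obtain ⟨l₂, l₃, rfl⟩ := List.append_of_mem hb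
      exact ⟨[], a, l₂, b, l₃, rfl, hab⟩
    · obtain ⟨l₁, c, l₂, b, l₃, rfl, hcb⟩ := ih hl
      exact ⟨a :: l₁, c, l₂, b, l₃, rfl, hcb⟩

/-- A directed multigraph on the vertex type `ν`: a set of arcs, each with a tail and a head.
Tails and heads are total on `ε`, so that reorienting arcs or restricting to fewer of them leaves
the type of arcs unchanged. -/
structure MultiDigraph (ε ν : Type*) where
  tail : ε → ν
  head : ε → ν
  arcs : Set ε

namespace MultiDigraph

variable {ε ν : Type*} {D : MultiDigraph ε ν} {u v w r x : ν} {a : ε} {K L : List ε}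

/-- `D.Walk u L v`: the list of arcs `L` is a directed walk from `u` to `v`. -/
def Walk (D : MultiDigraph ε ν) : ν → List ε → ν → Prop
  | u, [], v => u = v
  | u, a :: L, v => a ∈ D.arcs ∧ D.tail a = u ∧ D.Walk (D.head a) L v

@[simp]
lemma walk_nil : D.Walk u [] v ↔ u = v := Iff.rfl

@[simp]
lemma walk_cons : D.Walk u (a :: L) v ↔ a ∈ D.arcs ∧ D.tail a = u ∧ D.Walk (D.head a) L v :=
  Iff.rfl

lemma walk_append : D.Walk u (K ++ L) w ↔ ∃ v, D.Walk u K v ∧ D.Walk v L w := by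
  induction K generalizing u with
  | nil => simp
  | cons a K ih => simp [ih, and_assoc]

lemma walk_append_cons : D.Walk u (K ++ a :: L) v ↔
    a ∈ D.arcs ∧ D.Walk u K (D.tail a) ∧ D.Walk (D.head a) L v := by
  simp only [walk_append, walk_cons]
  grind

lemma walk_concat : D.Walk u (L ++ [a]) v ↔ a ∈ D.arcs ∧ D.Walk u L (D.tail a) ∧ D.head a = v := by
  simp [walk_append_cons]

lemma Walk.append (hK : D.Walk u K v) (hL : D.Walk v L w) : D.Walk u (K ++ L) w :=
  walk_append.2 ⟨v, hK, hL⟩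

lemma Walk.mem_arcs (h : D.Walk u L v) : ∀ a ∈ L, a ∈ D.arcs := by
  induction L generalizing u with
  | nil => simp
  | cons b L ih => exact List.forall_mem_cons.2 ⟨h.1, ih h.2.2⟩

lemma Walk.exists_shorter (h : D.Walk u L v) (hL : ¬ L.Nodup) :
    ∃ M ≠ [], D.Walk u M v ∧ M.length < L.length := by
  obtain ⟨l₁, a, l₂, b, l₃, rfl, hab⟩ := exists_eq_append_of_not_pairwise hL
  obtain rfl := not_not.1 hab
  obtain ⟨ha, h₁, h⟩ := walk_append_cons.1 h
  exact ⟨l₁ ++ a :: l₃, by simp, walk_append_cons.2 ⟨ha, h₁, (walk_append_cons.1 h).2.2⟩, by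
    simp only [List.length_append, List.length_cons]
    omega⟩

lemma Walk.exists_nodup (h : D.Walk u L v) : ∃ M, D.Walk u M v ∧ M.Nodup := by
  obtain ⟨M, hM⟩ := exists_minimalFor_of_wellFoundedLT (D.Walk u · v) List.length ⟨L, h⟩
  refine ⟨M, hM.prop, ?_⟩
  by_contra hnd
  obtain ⟨N, -, hN, hlt⟩ := hM.prop.exists_shorter hnd
  exact hM.not_prop_of_lt hlt hN

lemma Walk.sum_map_sub (h : D.Walk u L v) (φ : ν → ℤ) :
    (L.map fun a => φ (D.head a) - φ (D.tail a)).sum = φ v - φ u := by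
  induction L generalizing u with
  | nil => simp [walk_nil.1 h]
  | cons a L ih =>
    obtain ⟨-, rfl, h⟩ := h
    simp [ih h]

/-- The set of arcs of `D` that enter `X`. -/
def inCut (D : MultiDigraph ε ν) (X : Set ν) : Set ε :=
  {a ∈ D.arcs | D.tail a ∉ X ∧ D.head a ∈ X}

lemma Walk.exists_mem_inCut (h : D.Walk u L v) {X : Set ν} (hu : u ∉ X) (hv : v ∈ X) :
    ∃ a ∈ L, a ∈ D.inCut X := by
  induction L generalizing u with
  | nil => exact absurd (walk_nil.1 h ▸ hv) hu
  | cons a L ih =>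
    obtain ⟨ha, rfl, h⟩ := h
    by_cases haX : D.head a ∈ X
    · exact ⟨a, List.mem_cons_self, ha, hu, haX⟩
    · obtain ⟨b, hb, hbX⟩ := ih h haX
      exact ⟨b, List.mem_cons_of_mem _ hb, hbX⟩

lemma exists_inCut_eq_empty (h : ∀ L, ¬ D.Walk r L x) : ∃ X, x ∈ X ∧ r ∉ X ∧ D.inCut X = ∅ := by
  refine ⟨{v | ∀ L, ¬ D.Walk r L v}, h, fun hr => hr [] rfl, ?_⟩
  refine Set.eq_empty_of_forall_notMem fun a ⟨ha, htail, hhead⟩ => ?_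
  obtain ⟨L, hL⟩ := not_forall_not.1 htail
  exact hhead (L ++ [a]) (walk_concat.2 ⟨ha, hL, rfl⟩)

/-- A flow of value `n` from `r` to `x` with values in `{0, 1}`, given by the finite set `F` of
arcs that carry flow. Conservation at the vertices is tested against potentials: the potential
`Pi.single v 1` gives the net inflow at `v`, and the indicator function of `X` the net inflow
into `X`. -/
structure IsFlow (D : MultiDigraph ε ν) (F : Finset ε) (r x : ν) (n : ℕ) : Prop where
  subset : ↑F ⊆ D.arcs
  sum_sub : ∀ φ : ν → ℤ, ∑ a ∈ F, (φ (D.head a) - φ (D.tail a)) = n * (φ x - φ r)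

variable {F : Finset ε} {n : ℕ}

lemma IsFlow.empty : D.IsFlow ∅ r x 0 := ⟨by simp, by simp⟩

lemma IsFlow.le_card (hF : D.IsFlow F r x n) (hrx : r ≠ x) : n ≤ F.card := by
  classical
  have hle : ∀ a ∈ F, (Pi.single x 1 : ν → ℤ) (D.head a) - (Pi.single x 1 : ν → ℤ) (D.tail a) ≤ 1 :=
    fun a _ => by
      simp only [Pi.single_apply]
      grind
  have hsum := Finset.sum_le_card_nsmul F _ 1 hle
  simpa [hF.sum_sub, hrx] using hsum

/-- The digraph `D` with its set of arcs replaced by `F`. -/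
def withArcs (D : MultiDigraph ε ν) (F : Set ε) : MultiDigraph ε ν :=
  { D with arcs := F }

lemma Walk.withArcs_mono {E F : Set ε} (h : (D.withArcs E).Walk u L v) (hEF : E ⊆ F) :
    (D.withArcs F).Walk u L v := by
  induction L generalizing u with
  | nil => exact h
  | cons a L ih => exact ⟨hEF h.1, h.2.1, ih h.2.2⟩

lemma IsFlow.exists_walk (hF : D.IsFlow F r x (n + 1)) :
    ∃ L, (D.withArcs F).Walk r L x := by
  classical
  by_contra! h
  obtain ⟨X, hx, hr, hX⟩ := exists_inCut_eq_empty h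
  have hle : ∀ a ∈ F, X.indicator (1 : ν → ℤ) (D.head a) - X.indicator 1 (D.tail a) ≤ 0 := by
    intro a ha
    have haX : ¬ (D.tail a ∉ X ∧ D.head a ∈ X) := fun haX =>
      Set.notMem_empty a (hX ▸ ⟨ha, haX⟩)
    simp only [Set.indicator_apply, Pi.one_apply]
    grind
  have hsum := Finset.sum_nonpos hle
  simp only [hF.sum_sub, Set.indicator_of_mem hx, Set.indicator_of_notMem hr, Pi.one_apply,
    Nat.cast_add, Nat.cast_one] at hsum
  lia

lemma IsFlow.sdiff [DecidableEq ε] (hF : D.IsFlow F r x (n + 1)) (hL : (D.withArcs F).Walk r L x)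
    (hnd : L.Nodup) : D.IsFlow (F \ L.toFinset) r x n := by
  refine ⟨fun a ha => hF.subset (Finset.sdiff_subset ha), fun φ => ?_⟩
  have hLF : L.toFinset ⊆ F := fun a ha => hL.mem_arcs a (List.mem_toFinset.1 ha)
  have hsum := Finset.sum_sdiff (f := fun a => φ (D.head a) - φ (D.tail a)) hLF
  have hwalk : (L.map fun a => φ (D.head a) - φ (D.tail a)).sum = φ x - φ r := hL.sum_map_sub φ
  rw [List.sum_toFinset _ hnd, hF.sum_sub, hwalk] at hsum
  push_cast at hsum
  linarith

lemma IsFlow.exists_disjoint_walks (hF : D.IsFlow F r x n) :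
    ∃ P : Fin n → List ε, (∀ i, (D.withArcs F).Walk r (P i) x ∧ (P i).Nodup) ∧
      Pairwise fun i j => (P i).Disjoint (P j) := by
  classical
  induction n generalizing F with
  | zero => exact ⟨Fin.elim0, fun i => i.elim0, fun i => i.elim0⟩
  | succ n ih =>
    obtain ⟨L, hL, hnd⟩ := hF.exists_walk.elim fun _ h => h.exists_nodup
    obtain ⟨P, hP, hdis⟩ := ih (hF.sdiff hL hnd)
    have hLP : ∀ i, L.Disjoint (P i) := fun i a haL haP => by
      simpa [haL] using Finset.mem_sdiff.1 ((hP i).1.mem_arcs a haP)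
    refine ⟨Fin.cons L P, fun i => ?_, fun i j hij => ?_⟩
    · cases i using Fin.cases with
      | zero => exact ⟨hL, hnd⟩
      | succ i => exact ⟨(hP i).1.withArcs_mono (mod_cast Finset.sdiff_subset), (hP i).2⟩
    · cases i using Fin.cases <;> cases j using Fin.cases
      · exact absurd rfl hij
      · exact hLP _
      · exact (hLP _).symm
      · exact hdis fun h => hij (congrArg Fin.succ h)

/-- The residual digraph of a flow: the arcs in `F` are reversed. -/
def residual [DecidableEq ε] (D : MultiDigraph ε ν) (F : Finset ε) : MultiDigraph ε ν where
  tail a := if a ∈ F then D.head a else D.tail a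
  head a := if a ∈ F then D.tail a else D.head a
  arcs := D.arcs

lemma IsFlow.symmDiff [DecidableEq ε] (hF : D.IsFlow F r x n)
    (hL : (D.residual F).Walk r L x) (hnd : L.Nodup) :
    D.IsFlow (symmDiff F L.toFinset) r x (n + 1) := by
  refine ⟨fun a ha => ?_, fun φ => ?_⟩
  · rcases Finset.mem_symmDiff.1 ha with ⟨haF, -⟩ | ⟨haL, -⟩
    · exact hF.subset haF
    · exact hL.mem_arcs a (List.mem_toFinset.1 haL)
  set f : ε → ℤ := fun a => φ (D.head a) - φ (D.tail a) with hf
  have hwalk : ∑ a ∈ L.toFinset, (if a ∈ F then -f a else f a) = φ x - φ r := by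
    rw [List.sum_toFinset _ hnd, ← hL.sum_map_sub φ]
    congr! 2
    ext a
    simp only [residual, hf]
    split_ifs <;> ring
  have hL_sum := hwalk
  rw [Finset.sum_ite, Finset.filter_mem_eq_inter, Finset.filter_notMem_eq_sdiff,
    Finset.sum_neg_distrib] at hL_sum
  have hF_sum := Finset.sum_inter_add_sum_sdiff F L.toFinset f
  rw [Finset.inter_comm, hF.sum_sub φ] at hF_sum
  rw [symmDiff_def, Finset.sup_eq_union, Finset.sum_union disjoint_sdiff_sdiff]
  push_cast
  linarith

lemma IsFlow.encard_inCut [DecidableEq ε] (hF : D.IsFlow F r x n) {X : Set ν} (hx : x ∈ X)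
    (hr : r ∉ X) (hX : (D.residual F).inCut X = ∅) : (D.inCut X).encard = n := by
  classical
  have hres : ∀ a ∈ D.arcs, ¬ ((D.residual F).tail a ∉ X ∧ (D.residual F).head a ∈ X) :=
    fun a ha haX => Set.notMem_empty a (hX ▸ ⟨ha, haX⟩)
  simp only [residual] at hres
  have hcut : D.inCut X = ↑(F.filter (· ∈ D.inCut X)) := by
    ext a
    simp only [inCut]
    grind
  have hterm : ∀ a ∈ F, X.indicator (1 : ν → ℤ) (D.head a) - X.indicator 1 (D.tail a) =
      if a ∈ D.inCut X then 1 else 0 := by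
    intro a haF
    have ha := hF.subset haF
    have haX := hres a ha
    simp only [Set.indicator_apply, Pi.one_apply, inCut, Set.mem_ofPred_eq]
    grind
  have hsum := hF.sum_sub (X.indicator 1)
  rw [Finset.sum_congr rfl hterm, Finset.sum_boole, Set.indicator_of_mem hx,
    Set.indicator_of_notMem hr, Pi.one_apply, sub_zero, mul_one] at hsum
  rw [hcut, Set.encard_coe_eq_coe_finsetCard]
  exact_mod_cast hsum

theorem exists_disjoint_walks_and_cut (D : MultiDigraph ε ν) (hfin : D.arcs.Finite) (hrx : r ≠ x) :
    ∃ (n : ℕ) (P : Fin n → List ε) (X : Set ν), (∀ i, D.Walk r (P i) x ∧ (P i).Nodup) ∧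
      (Pairwise fun i j => (P i).Disjoint (P j)) ∧ x ∈ X ∧ r ∉ X ∧ (D.inCut X).encard = n := by
  classical
  obtain ⟨n, ⟨F, hF⟩, hmax⟩ : ∃ n, (∃ F, D.IsFlow F r x n) ∧ ∀ F, ¬ D.IsFlow F r x (n + 1) := by
    by_contra! h
    have hflow (n : ℕ) : ∃ F, D.IsFlow F r x n := n.rec ⟨∅, .empty⟩ h
    obtain ⟨F, hF⟩ := hflow (hfin.toFinset.card + 1)
    have hle := (hF.le_card hrx).trans
      (Finset.card_le_card fun a ha => hfin.mem_toFinset.2 (hF.subset ha))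
    lia
  obtain ⟨P, hP, hdis⟩ := hF.exists_disjoint_walks
  obtain ⟨X, hx, hr, hX⟩ : ∃ X, x ∈ X ∧ r ∉ X ∧ (D.residual F).inCut X = ∅ := by
    refine exists_inCut_eq_empty fun L hL => ?_
    obtain ⟨M, hM, hnd⟩ := hL.exists_nodup
    exact hmax _ (hF.symmDiff hM hnd)
  exact ⟨n, P, X, fun i => ⟨(hP i).1.withArcs_mono hF.subset, (hP i).2⟩, hdis, hx, hr,
    hF.encard_inCut hx hr hX⟩

end MultiDigraph

/-! ### Blossoms in skew-symmetric digraphs -/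

/-- A vertex together with a sign: the state of a walk at that vertex. -/
abbrev SignedVertex (V : Type*) : Type _ := V × ℤˣ

namespace SignedVertex

variable {V : Type*}

/-- The same vertex with the opposite sign. -/
def opp (p : SignedVertex V) : SignedVertex V := (p.1, -p.2)

@[simp]
lemma opp_opp (p : SignedVertex V) : p.opp.opp = p := by simp [opp]

@[simp]
lemma opp_fst (p : SignedVertex V) : p.opp.1 = p.1 := rfl

lemma opp_ne (p : SignedVertex V) : p.opp ≠ p := fun h =>
  neg_units_ne_self p.2 (congrArg Prod.snd h)

lemma eq_or_eq_opp {p q : SignedVertex V} (h : p.1 = q.1) : p = q ∨ p = q.opp := by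
  by_cases hsign : p.2 = q.2
  · exact .inl (Prod.ext h hsign)
  · exact .inr (Prod.ext h (Int.units_ne_iff_eq_neg.1 hsign))

end SignedVertex

/-- A skew-symmetric digraph: every arc has a reverse, which runs from the opposite of its head to
the opposite of its tail. It encodes a bidirected graph as follows. The arcs are the oriented edges;
the head of an arc is its end together with the sign there, and its tail is its start together with
the negative of the sign there, so that the walks are the sequences that change sign at every
internal vertex. -/
structure SkewDigraph (O V : Type*) extends MultiDigraph O (SignedVertex V) where
  rev : O → O
  rev_rev : ∀ o, rev (rev o) = o
  tail_rev : ∀ o, tail (rev o) = (head o).opp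
  rev_mem : ∀ o ∈ arcs, rev o ∈ arcs

namespace SkewDigraph

variable {O V : Type*} {S : SkewDigraph O V} {p q m : SignedVertex V} {K L P : List O} {a b f : O}
  {r v : V} {X : Set V}

attribute [simp] rev_rev tail_rev

@[simp]
lemma head_rev (S : SkewDigraph O V) (o : O) : S.head (S.rev o) = (S.tail o).opp := by
  rw [← SignedVertex.opp_opp (S.head _), ← tail_rev, rev_rev]

/-- The list of the reverses of the arcs in `L`, in the opposite order. -/
def revList (S : SkewDigraph O V) (L : List O) : List O := (L.map S.rev).reverse

@[simp]
lemma revList_nil : S.revList [] = [] := rfl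

@[simp]
lemma revList_cons : S.revList (a :: L) = S.revList L ++ [S.rev a] := by simp [revList]

@[simp]
lemma revList_append : S.revList (K ++ L) = S.revList L ++ S.revList K := by simp [revList]

@[simp]
lemma length_revList : (S.revList L).length = L.length := by simp [revList]

lemma mem_revList : a ∈ S.revList L ↔ S.rev a ∈ L := by
  simp only [revList, List.mem_reverse, List.mem_map]
  exact ⟨fun ⟨b, hb, hba⟩ => hba ▸ (S.rev_rev b).symm ▸ hb, fun h => ⟨_, h, S.rev_rev a⟩⟩

lemma walk_revList (h : S.Walk p L q) : S.Walk q.opp (S.revList L) p.opp := by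
  induction L generalizing p with
  | nil => exact congrArg _ h.symm
  | cons a L ih =>
    obtain ⟨ha, rfl, h⟩ := h
    rw [revList_cons, MultiDigraph.walk_concat]
    exact ⟨S.rev_mem a ha, by simpa using ih h, by simp⟩

/-- The arcs `a` and `b` are orientations of different edges. -/
def Apart (S : SkewDigraph O V) (a b : O) : Prop := a ≠ b ∧ a ≠ S.rev b

lemma Apart.symm (h : S.Apart a b) : S.Apart b a :=
  ⟨h.1.symm, fun hba => h.2 (by rw [hba, rev_rev])⟩

lemma Apart.rev (h : S.Apart a b) : S.Apart (S.rev a) (S.rev b) := by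
  have hinj : Function.Injective S.rev := Function.LeftInverse.injective S.rev_rev
  exact ⟨hinj.ne h.1, hinj.ne h.2⟩

/-- `S.IsTrail p L q`: the walk `L` from `p` to `q` uses every edge at most once. -/
structure IsTrail (S : SkewDigraph O V) (p : SignedVertex V) (L : List O) (q : SignedVertex V) :
    Prop where
  walk : S.Walk p L q
  pairwise_apart : L.Pairwise S.Apart

namespace IsTrail

lemma nil : S.IsTrail p [] p := ⟨rfl, .nil⟩

lemma rev (h : S.IsTrail p L q) : S.IsTrail q.opp (S.revList L) p.opp := by
  refine ⟨walk_revList h.walk, ?_⟩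
  rw [revList, List.pairwise_reverse, List.pairwise_map]
  exact h.pairwise_apart.imp fun hab => hab.rev.symm

lemma append (hK : S.IsTrail p K m) (hL : S.IsTrail m L q) (hKL : ∀ a ∈ K, ∀ b ∈ L, S.Apart a b) :
    S.IsTrail p (K ++ L) q :=
  ⟨hK.walk.append hL.walk, List.pairwise_append.2 ⟨hK.pairwise_apart, hL.pairwise_apart, hKL⟩⟩

lemma split (h : S.IsTrail p (K ++ L) q) : ∃ m, S.IsTrail p K m ∧ S.IsTrail m L q := by
  obtain ⟨m, hK, hL⟩ := MultiDigraph.walk_append.1 h.walk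
  obtain ⟨hK', hL', -⟩ := List.pairwise_append.1 h.pairwise_apart
  exact ⟨m, ⟨hK, hK'⟩, hL, hL'⟩

lemma split_at (h : S.IsTrail p (K ++ a :: L) q) :
    S.IsTrail p K (S.tail a) ∧ S.IsTrail (S.tail a) (a :: L) q := by
  obtain ⟨m, hK, hL⟩ := h.split
  obtain rfl := hL.walk.2.1
  exact ⟨hK, hL⟩

end IsTrail

/-- Both ends of the arc `a` are at vertices in `X`. -/
def Inner (S : SkewDigraph O V) (X : Set V) (a : O) : Prop :=
  (S.tail a).1 ∈ X ∧ (S.head a).1 ∈ X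

@[simp]
lemma inner_rev : S.Inner X (S.rev a) ↔ S.Inner X a := by
  simp [Inner, and_comm]

lemma Inner.apart (ha : S.Inner X a) (hb : ¬ S.Inner X b) : S.Apart a b :=
  ⟨fun h => hb (h ▸ ha), fun h => hb (inner_rev.1 (h ▸ ha))⟩

/-- A blossom: the arc `f` enters `X`, and after `f` every state at a vertex in `X` can be
reached by a trail inside `X`. -/
structure IsBlossom (S : SkewDigraph O V) (f : O) (X : Set V) : Prop where
  mem : f ∈ S.arcs
  tail_notMem : (S.tail f).1 ∉ X
  head_mem : (S.head f).1 ∈ X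
  exists_trail : ∀ p : SignedVertex V, p.1 ∈ X →
    ∃ Z, S.IsTrail (S.head f) Z p ∧ ∀ a ∈ Z, S.Inner X a

lemma IsBlossom.exists_inner (h : S.IsBlossom f X) : ∃ a ∈ S.arcs, S.Inner X a := by
  obtain ⟨_ | ⟨a, Z⟩, hZ, hX⟩ := h.exists_trail (S.head f).opp h.head_mem
  · exact absurd hZ.walk.symm (SignedVertex.opp_ne _)
  · exact ⟨a, hZ.walk.1, hX a List.mem_cons_self⟩

/-- A nonempty walk that starts and ends at the vertex `r`, in either of its states. -/
def IsClosedWalk (S : SkewDigraph O V) (r : V) (L : List O) : Prop :=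
  L ≠ [] ∧ ∃ p q, S.Walk p L q ∧ p.1 = r ∧ q.1 = r

/-- A closed walk of minimum length among the closed walks at `r`. -/
def IsShortestClosedWalk (S : SkewDigraph O V) (r : V) : List O → Prop :=
  MinimalFor (S.IsClosedWalk r) List.length

namespace IsShortestClosedWalk

lemma length_le (h : S.IsShortestClosedWalk r K) (hL : S.IsClosedWalk r L) :
    K.length ≤ L.length := by
  by_contra! hlt
  exact h.not_prop_of_lt hlt hL

lemma nodup (h : S.IsShortestClosedWalk r L) : L.Nodup := by
  by_contra hnd
  obtain ⟨-, p, q, hL, hp, hq⟩ := h.prop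
  obtain ⟨M, hM₀, hM, hlt⟩ := hL.exists_shorter hnd
  exact (h.length_le ⟨hM₀, p, q, hM, hp, hq⟩).not_gt hlt

lemma fold {L₁ L₂ L₃ : List O}
    (h : S.IsShortestClosedWalk r (L₁ ++ a :: (L₂ ++ S.rev a :: L₃))) :
    L₁.length = L₃.length ∧
      S.IsShortestClosedWalk r ((L₁ ++ [a]) ++ L₂ ++ S.revList (L₁ ++ [a])) := by
  obtain ⟨-, p, q, hL, hp, hq⟩ := h.prop
  obtain ⟨ha, h₁, hL⟩ := MultiDigraph.walk_append_cons.1 hL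
  obtain ⟨ha', h₂, h₃⟩ := MultiDigraph.walk_append_cons.1 hL
  have hstart : S.Walk p (L₁ ++ [a]) (S.head a) := MultiDigraph.walk_concat.2 ⟨ha, h₁, rfl⟩
  have hmid : S.Walk (S.head a) L₂ (S.head a).opp := by rwa [tail_rev] at h₂
  have hend : S.Walk (S.head a).opp (S.rev a :: L₃) q := ⟨ha', S.tail_rev a, h₃⟩
  have hfst : S.IsClosedWalk r ((L₁ ++ [a]) ++ L₂ ++ S.revList (L₁ ++ [a])) :=
    ⟨by simp, p, p.opp, (hstart.append hmid).append (walk_revList hstart), hp, hp⟩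
  have hsnd : S.IsClosedWalk r (S.revList (S.rev a :: L₃) ++ (L₂ ++ S.rev a :: L₃)) :=
    ⟨by simp, q.opp, q, (walk_revList hend).append
      (by rw [SignedVertex.opp_opp]; exact hmid.append hend), hq, hq⟩
  have hle := h.length_le hfst
  have hle' := h.length_le hsnd
  simp only [List.length_append, List.length_cons, length_revList, List.length_nil] at hle hle'
  refine ⟨by omega, hfst, fun L hL _ => (le_trans ?_ (h.length_le hL))⟩
  simp only [List.length_append, List.length_cons, length_revList, List.length_nil]
  omega

end IsShortestClosedWalk

/-- A shortest closed walk at `r` that runs along a stem `P`, around a cycle `K` and back along the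
stem, where stem and cycle form a trail. -/
structure IsLollipop (S : SkewDigraph O V) (r : V) (P K : List O) : Prop where
  isShortestClosedWalk : S.IsShortestClosedWalk r (P ++ K ++ S.revList P)
  pairwise_apart : (P ++ K).Pairwise S.Apart

-- Among the shortest closed walks of the shape `P ++ K ++ S.revList P` take one with `K` shortest.
lemma exists_isLollipop (h : S.IsClosedWalk r L) : ∃ P K, S.IsLollipop r P K := by
  obtain ⟨L₀, hL₀ : S.IsShortestClosedWalk r L₀⟩ :=
    exists_minimalFor_of_wellFoundedLT _ List.length ⟨L, h⟩
  obtain ⟨⟨P, K⟩, hPK⟩ := exists_minimalFor_of_wellFoundedLT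
    (fun PK : List O × List O => S.IsShortestClosedWalk r (PK.1 ++ PK.2 ++ S.revList PK.1))
    (fun PK => PK.2.length) ⟨([], L₀), by simpa using hL₀⟩
  have hshort : S.IsShortestClosedWalk r (P ++ K ++ S.revList P) := hPK.prop
  refine ⟨P, K, hshort, ?_⟩
  by_contra hpw
  obtain ⟨L₁, a, L₂, b, L₃, hL, hab⟩ := exists_eq_append_of_not_pairwise hpw
  have hne : a ≠ b := by
    rintro rfl
    have hnd := (List.nodup_append.1 hshort.nodup).1
    rw [hL, List.nodup_append, List.nodup_cons] at hnd
    exact hnd.2.1.1 (by simp)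
  obtain rfl : b = S.rev a := by
    simp only [Apart, not_and_or, not_not] at hab
    rw [hab.resolve_left hne, rev_rev]
  have hfold : S.IsShortestClosedWalk r (L₁ ++ a :: (L₂ ++ S.rev a :: (L₃ ++ S.revList P))) := by
    simpa [hL] using hshort
  obtain ⟨hlen, hfold⟩ := hfold.fold
  have hle : K.length ≤ L₂.length := by
    by_contra! hlt
    exact hPK.not_prop_of_lt (j := (L₁ ++ [a], L₂)) hlt hfold
  have hlenL := congrArg List.length hL
  simp only [List.length_append, List.length_cons, length_revList] at hlen hlenL
  omega

namespace IsLollipop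

lemma exists_walk (h : S.IsLollipop r (P ++ [f]) K) : ∃ p, p.1 = r ∧
    S.Walk p (P ++ [f]) (S.head f) ∧ S.Walk (S.head f) K (S.head f).opp := by
  obtain ⟨-, p, q, hw, hp, -⟩ := h.isShortestClosedWalk.prop
  obtain ⟨m, hPK, hrev⟩ := MultiDigraph.walk_append.1 hw
  obtain ⟨m', hP, hK⟩ := MultiDigraph.walk_append.1 hPK
  obtain rfl := (MultiDigraph.walk_concat.1 hP).2.2
  obtain rfl : S.tail (S.rev f) = m := by
    rw [revList_append] at hrev
    exact hrev.2.1
  exact ⟨p, hp, hP, S.tail_rev f ▸ hK⟩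

lemma length_le (h : S.IsLollipop r P K) (hw : S.Walk p L q) (hp : p.1 = r) (hq : q.1 = r)
    (hL : L ≠ []) : 2 * P.length + K.length ≤ L.length := by
  have hle := h.isShortestClosedWalk.length_le ⟨hL, p, q, hw, hp, hq⟩
  simp only [List.length_append, length_revList] at hle
  omega

end IsLollipop

/-- The vertices at which the arcs in `L` start. -/
def tailVertices (S : SkewDigraph O V) (L : List O) : Set V := {v | ∃ a ∈ L, (S.tail a).1 = v}

lemma inner_tailVertices (h : S.Walk p L q) (hpq : p.1 = q.1) :
    ∀ a ∈ L, S.Inner (S.tailVertices L) a := by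
  intro a ha
  refine ⟨⟨a, ha, rfl⟩, ?_⟩
  obtain ⟨K, M, rfl⟩ := List.append_of_mem ha
  obtain ⟨-, h₁, h₂⟩ := MultiDigraph.walk_append_cons.1 h
  cases M with
  | cons b M => exact ⟨b, by simp, congrArg Prod.fst h₂.2.1⟩
  | nil =>
    rw [MultiDigraph.walk_nil.1 h₂, ← hpq]
    cases K with
    | nil => exact ⟨a, by simp, by rw [MultiDigraph.walk_nil.1 h₁]⟩
    | cons b K => exact ⟨b, by simp, congrArg Prod.fst h₁.2.1⟩

-- The state at the tail of an arc of the cycle is reached along the cycle, and its opposite by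
-- going round the other way.
lemma IsTrail.exists_trail_of_mem_tailVertices (h : S.IsTrail p K p.opp)
    (hq : q.1 ∈ S.tailVertices K) :
    ∃ Z, S.IsTrail p Z q ∧ ∀ a ∈ Z, S.Inner (S.tailVertices K) a := by
  obtain ⟨k, hk, hkq⟩ := hq
  have hinner := inner_tailVertices h.walk rfl
  obtain ⟨K₁, K₂, hK⟩ := List.append_of_mem hk
  obtain ⟨h₁, h₂⟩ := (hK ▸ h).split_at
  rcases SignedVertex.eq_or_eq_opp hkq.symm with rfl | rfl
  · exact ⟨K₁, h₁, fun a ha => hinner a (by simp [hK, ha])⟩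
  · refine ⟨S.revList (k :: K₂), by simpa using h₂.rev, fun a ha => ?_⟩
    exact inner_rev.1 (hinner _ (hK ▸ List.mem_append_right _ (mem_revList.1 ha)))

lemma IsLollipop.stem_notMem_tailVertices (h : S.IsLollipop r (P ++ [f]) K) :
    ∀ a ∈ P ++ [f], (S.tail a).1 ∉ S.tailVertices K := by
  obtain ⟨p, hp, hP, hK⟩ := h.exists_walk
  rintro a ha ⟨k, hk, hka⟩
  obtain ⟨K₁, K₂, rfl⟩ := List.append_of_mem hk
  obtain ⟨P₁, P₂, hPa⟩ := List.append_of_mem ha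
  obtain ⟨hk', hK₁, hK₂⟩ := MultiDigraph.walk_append_cons.1 hK
  obtain ⟨-, hP₁, -⟩ := MultiDigraph.walk_append_cons.1 (hPa ▸ hP)
  have hlen := congrArg List.length hPa
  rcases SignedVertex.eq_or_eq_opp hka with hka | hka
  · have hshort : S.Walk p (P₁ ++ k :: (K₂ ++ S.revList (P ++ [f]))) p.opp :=
      MultiDigraph.walk_append_cons.2 ⟨hk', hka ▸ hP₁, hK₂.append (walk_revList hP)⟩
    have hle := h.length_le hshort hp hp (by simp)
    simp only [List.length_append, List.length_cons, length_revList] at hle hlen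
    omega
  · have hshort : S.Walk p (P ++ [f] ++ (K₁ ++ S.revList P₁)) p.opp :=
      hP.append (hK₁.append (hka ▸ walk_revList hP₁))
    have hle := h.length_le hshort hp hp (by simp)
    simp only [List.length_append, List.length_cons, length_revList] at hle hlen
    omega

lemma IsLollipop.isBlossom (h : S.IsLollipop r (P ++ [f]) K) :
    S.IsBlossom f (S.tailVertices K) := by
  obtain ⟨p, -, hP, hK⟩ := h.exists_walk
  have hKtrail : S.IsTrail (S.head f) K (S.head f).opp :=
    ⟨hK, (List.pairwise_append.1 h.pairwise_apart).2.1⟩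
  refine ⟨hP.mem_arcs f (by simp), h.stem_notMem_tailVertices f (by simp), ?_,
    fun q hq => hKtrail.exists_trail_of_mem_tailVertices hq⟩
  cases K with
  | nil => exact absurd hK.symm (SignedVertex.opp_ne _)
  | cons k K => exact ⟨k, List.mem_cons_self, congrArg Prod.fst hK.2.1⟩

lemma exists_isBlossom (hr : ∀ L, S.IsClosedWalk r L → ¬ L.Pairwise S.Apart)
    (hL : S.IsClosedWalk r L) :
    ∃ f X P p, S.IsBlossom f X ∧ p.1 = r ∧ S.IsTrail p (P ++ [f]) (S.head f) ∧
      ∀ a ∈ P ++ [f], (S.tail a).1 ∉ X := by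
  obtain ⟨P, K, h⟩ := exists_isLollipop hL
  obtain rfl | ⟨P, f, rfl⟩ := List.eq_nil_or_concat' P
  · exact absurd (by simpa using h.pairwise_apart)
      (hr K (by simpa using h.isShortestClosedWalk.prop))
  · obtain ⟨p, hp, hP, -⟩ := h.exists_walk
    exact ⟨f, _, P, p, h.isBlossom, hp, ⟨hP, (List.pairwise_append.1 h.pairwise_apart).1⟩,
      h.stem_notMem_tailVertices⟩

/-! ### Contracting a blossom -/

variable {Y : Set V}

open scoped Classical in
/-- The map on vertices that contracts `X` to the vertex at the head of `f`. -/
noncomputable def collapse (S : SkewDigraph O V) (f : O) (X : Set V) (v : V) : V :=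
  if v ∈ X then (S.head f).1 else v

lemma collapse_of_mem (hv : v ∈ X) : S.collapse f X v = (S.head f).1 := if_pos hv

lemma collapse_of_notMem (hv : v ∉ X) : S.collapse f X v = v := if_neg hv

lemma collapse_mem_iff (hf : (S.head f).1 ∈ X) : S.collapse f X v ∈ X ↔ v ∈ X := by
  by_cases hv : v ∈ X
  · simp [collapse_of_mem hv, hf, hv]
  · simp [collapse_of_notMem hv, hv]

open scoped Classical in
/-- The skew-symmetric digraph in which the blossom at `f` with vertex set `X` is contracted to the
vertex at the head of `f`. The signs there are chosen such that a walk passes through this vertex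
if and only if it enters by `f` or leaves by the reverse of `f`, but not both. -/
noncomputable def contract (S : SkewDigraph O V) (f : O) (X : Set V) : SkewDigraph O V where
  tail a := if (S.tail a).1 ∈ X then
    if a = S.rev f then (S.head f).opp else S.head f else S.tail a
  head a := if (S.head a).1 ∈ X then
    if a = f then S.head f else (S.head f).opp else S.head a
  arcs := {a ∈ S.arcs | ¬ S.Inner X a}
  rev := S.rev
  rev_rev := S.rev_rev
  tail_rev a := by
    have hinj : Function.Injective S.rev := Function.LeftInverse.injective S.rev_rev
    simp only [tail_rev, SignedVertex.opp_fst, hinj.eq_iff]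
    split_ifs <;> simp
  rev_mem a ha := ⟨S.rev_mem a ha.1, fun h => ha.2 (inner_rev.1 h)⟩

lemma contract_tail_fst : ((S.contract f X).tail a).1 = S.collapse f X (S.tail a).1 := by
  simp only [contract, collapse]
  split_ifs <;> rfl

lemma contract_head_fst : ((S.contract f X).head a).1 = S.collapse f X (S.head a).1 := by
  simp only [contract, collapse]
  split_ifs <;> rfl

lemma contract_tail_mem_iff :
    ((S.contract f X).tail a).1 ∈ Y ↔ (S.tail a).1 ∈ S.collapse f X ⁻¹' Y := by
  rw [contract_tail_fst, Set.mem_preimage]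

lemma contract_head_mem_iff :
    ((S.contract f X).head a).1 ∈ Y ↔ (S.head a).1 ∈ S.collapse f X ⁻¹' Y := by
  rw [contract_head_fst, Set.mem_preimage]

lemma contract_inner_iff : (S.contract f X).Inner Y a ↔ S.Inner (S.collapse f X ⁻¹' Y) a :=
  and_congr contract_tail_mem_iff contract_head_mem_iff

lemma contract_tail (ha : (S.tail a).1 ∉ X) : (S.contract f X).tail a = S.tail a := if_neg ha

lemma contract_head (ha : (S.head a).1 ∉ X) : (S.contract f X).head a = S.head a := if_neg ha

lemma walk_contract (h : S.Walk p L q) (hL : ∀ a ∈ L, (S.tail a).1 ∉ X) (hq : q.1 ∉ X) :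
    (S.contract f X).Walk p L q := by
  induction L generalizing p with
  | nil => exact h
  | cons a L ih =>
    obtain ⟨ha, rfl, h⟩ := h
    rw [List.forall_mem_cons] at hL
    refine ⟨⟨ha, fun hX => hL.1 hX.1⟩, contract_tail hL.1, ?_⟩
    have hhead : (S.head a).1 ∉ X := by
      cases L with
      | nil => rwa [MultiDigraph.walk_nil.1 h]
      | cons b L => exact h.2.1 ▸ hL.2 b List.mem_cons_self
    rw [contract_head hhead]
    exact ih h hL.2

lemma IsBlossom.isTrail_contract (hX : S.IsBlossom f X) (h : S.IsTrail p (L ++ [f]) (S.head f))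
    (hL : ∀ a ∈ L, (S.tail a).1 ∉ X) :
    (S.contract f X).IsTrail p (L ++ [f]) ((S.contract f X).head f) := by
  obtain ⟨hf, hwalk, -⟩ := MultiDigraph.walk_concat.1 h.walk
  refine ⟨MultiDigraph.walk_concat.2 ⟨⟨hf, fun h => hX.tail_notMem h.1⟩, ?_, rfl⟩,
    h.pairwise_apart⟩
  rw [contract_tail hX.tail_notMem]
  exact walk_contract hwalk hL hX.tail_notMem

namespace IsBlossom

variable (hX : S.IsBlossom f X)
include hX

lemma tail_mem_iff (hab : (S.contract f X).tail b = (S.contract f X).head a) :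
    (S.tail b).1 ∈ X ↔ (S.head a).1 ∈ X := by
  have hfst := congrArg Prod.fst hab
  rw [contract_tail_fst, contract_head_fst] at hfst
  rw [← collapse_mem_iff hX.head_mem, hfst, collapse_mem_iff hX.head_mem]

lemma eq_or_eq_rev_of_pass (hab : (S.contract f X).tail b = (S.contract f X).head a)
    (ha : (S.head a).1 ∈ X) : a = f ∨ b = S.rev f := by
  have hb := (hX.tail_mem_iff hab).2 ha
  simp only [contract, if_pos hb, if_pos ha] at hab
  by_contra! hne
  rw [if_neg hne.1, if_neg hne.2] at hab
  exact SignedVertex.opp_ne _ hab.symm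

lemma exists_pass (hab : (S.contract f X).tail b = (S.contract f X).head a)
    (ha : (S.head a).1 ∈ X) : ∃ Z, S.IsTrail (S.head a) Z (S.tail b) ∧ ∀ z ∈ Z, S.Inner X z := by
  rcases hX.eq_or_eq_rev_of_pass hab ha with rfl | rfl
  · exact hX.exists_trail _ ((hX.tail_mem_iff hab).2 ha)
  · obtain ⟨Z, hZ, hZX⟩ := hX.exists_trail (S.head a).opp ha
    exact ⟨S.revList Z, by simpa using hZ.rev, fun z hz => inner_rev.1 (hZX _ (mem_revList.1 hz))⟩

lemma walk_of_contract (h : (S.contract f X).Walk ((S.contract f X).head a) L q) (hq : q.1 ∉ X)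
    (hf : f ∉ a :: L) (hf' : S.rev f ∉ L) : S.Walk (S.head a) L q := by
  induction L generalizing a with
  | nil =>
    obtain rfl := MultiDigraph.walk_nil.1 h
    rw [contract_head_fst, collapse_mem_iff hX.head_mem] at hq
    exact (contract_head hq).symm
  | cons b L ih =>
    obtain ⟨hb, hba, h⟩ := h
    have ha : (S.head a).1 ∉ X := fun ha => by
      rcases hX.eq_or_eq_rev_of_pass hba ha with rfl | rfl <;> simp at hf hf'
    have hb' : (S.tail b).1 ∉ X := fun h => ha ((hX.tail_mem_iff hba).1 h)
    rw [contract_tail hb', contract_head ha] at hba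
    exact ⟨hb.1, hba, ih h (List.not_mem_of_not_mem_cons hf) (List.not_mem_of_not_mem_cons hf')⟩

-- The blossom is passed at most once, since every pass uses `f` or its reverse.
lemma walk_of_pass (hba : (S.contract f X).tail b = (S.contract f X).head a)
    (ha : (S.head a).1 ∈ X) (h : (S.contract f X).Walk ((S.contract f X).head b) L q)
    (hpw : (a :: b :: L).Pairwise S.Apart) (hq : q.1 ∉ X) : S.Walk (S.head b) L q := by
  have hbf : b ≠ f := by
    rintro rfl
    exact hX.tail_notMem ((hX.tail_mem_iff hba).2 ha)
  obtain ⟨haL, hpw⟩ := List.pairwise_cons.1 hpw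
  obtain ⟨hbL, -⟩ := List.pairwise_cons.1 hpw
  rcases hX.eq_or_eq_rev_of_pass hba ha with rfl | rfl
  · exact hX.walk_of_contract h hq (fun hmem => (haL _ hmem).1 rfl)
      fun hmem => (haL _ (List.mem_cons_of_mem _ hmem)).2 (S.rev_rev a).symm
  · exact hX.walk_of_contract h hq
      (List.not_mem_cons_of_ne_of_not_mem hbf.symm fun hmem => (hbL _ hmem).2 rfl)
      fun hmem => (hbL _ hmem).1 rfl

lemma exists_lift (h : (S.contract f X).Walk ((S.contract f X).head a) L q)
    (ha : ¬ S.Inner X a) (hpw : (a :: L).Pairwise S.Apart) (hq : q.1 ∉ X) :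
    ∃ M, S.Walk (S.head a) M q ∧ (a :: M).Pairwise S.Apart ∧
      ∀ c ∈ M, c ∈ L ∨ S.Inner X c ∧ ∃ b ∈ L, (S.tail b).1 ∈ X := by
  induction L generalizing a with
  | nil =>
    obtain rfl := MultiDigraph.walk_nil.1 h
    rw [contract_head_fst, collapse_mem_iff hX.head_mem] at hq
    exact ⟨[], (contract_head hq).symm, hpw, by simp⟩
  | cons b L ih =>
    have hbL_mem := h.mem_arcs
    obtain ⟨hb, hba, h⟩ := h
    obtain ⟨hab, hpwb⟩ := List.pairwise_cons.1 hpw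
    by_cases haX : (S.head a).1 ∈ X
    · have hbX := (hX.tail_mem_iff hba).2 haX
      obtain ⟨Z, hZ, hZX⟩ := hX.exists_pass hba haX
      have hbL := hX.walk_of_pass hba haX h hpw hq
      refine ⟨Z ++ b :: L, hZ.walk.append ⟨hb.1, rfl, hbL⟩, ?_, ?_⟩
      · refine List.pairwise_cons.2 ⟨fun c hc => ?_, List.pairwise_append.2
          ⟨hZ.pairwise_apart, hpwb, fun z hz c hc => (hZX z hz).apart (hbL_mem c hc).2⟩⟩
        exact (List.mem_append.1 hc).elim (fun hc => ((hZX c hc).apart ha).symm) (hab c)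
      · intro c hc
        rcases List.mem_append.1 hc with hc | hc
        · exact .inr ⟨hZX c hc, b, List.mem_cons_self, hbX⟩
        · exact .inl hc
    · obtain ⟨M, hM, hMpw, hML⟩ := ih h hb.2 hpwb
      have hbX : (S.tail b).1 ∉ X := fun h => haX ((hX.tail_mem_iff hba).1 h)
      rw [contract_tail hbX, contract_head haX] at hba
      have habM : ∀ c ∈ b :: M, S.Apart a c := List.forall_mem_cons.2
        ⟨hab b List.mem_cons_self, fun c hc => (hML c hc).elim
          (fun hcL => hab c (List.mem_cons_of_mem _ hcL)) fun hcX => (hcX.1.apart ha).symm⟩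
      exact ⟨b :: M, ⟨hb.1, hba, hM⟩, List.pairwise_cons.2 ⟨habM, hMpw⟩, by grind⟩

lemma not_pairwise_contract (hr : r ∉ X)
    (hS : ∀ L, S.IsClosedWalk r L → ¬ L.Pairwise S.Apart)
    (hL : (S.contract f X).IsClosedWalk r L) : ¬ L.Pairwise S.Apart := by
  intro hpw
  obtain ⟨hne, p, q, hw, hp, hq⟩ := hL
  obtain ⟨a, L, rfl⟩ := List.exists_cons_of_ne_nil hne
  obtain ⟨ha, hap, hw⟩ := hw
  have haX : (S.tail a).1 ∉ X := by
    rw [← collapse_mem_iff hX.head_mem, ← contract_tail_fst, hap, hp]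
    exact hr
  obtain ⟨M, hM, hMpw, -⟩ := hX.exists_lift hw ha.2 hpw (hq ▸ hr)
  refine hS (a :: M) ⟨List.cons_ne_nil _ _, p, q, ⟨ha.1, ?_, hM⟩, hp, hq⟩ hMpw
  rw [← hap, contract_tail haX]

end IsBlossom

/-! ### Barriers -/

variable {e : O} {c : V → V} {blobs : Set V} {A : Set O}

namespace IsBlossom

lemma pairwise_cons (hX : S.IsBlossom f X) (hL : L.Pairwise S.Apart)
    (hLX : ∀ a ∈ L, S.Inner X a) : (f :: L).Pairwise S.Apart :=
  List.pairwise_cons.2 ⟨fun a ha => ((hLX a ha).apart fun h => hX.tail_notMem h.1).symm, hL⟩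

lemma eq_of_contract_head_eq (hX : S.IsBlossom f X) (ha : (S.contract f X).head a = S.head f) :
    a = f := by
  have haX : (S.head a).1 ∈ X := by
    rw [← collapse_mem_iff hX.head_mem, ← contract_head_fst, ha]
    exact hX.head_mem
  by_contra hne
  simp only [contract, if_pos haX, if_neg hne] at ha
  exact SignedVertex.opp_ne _ ha

-- A trail of the contracted digraph that reaches the state `S.head f` ends with the arc `f`.
lemma exists_trail_of_contract_of_mem (hX : S.IsBlossom f X) (hY : (S.contract f X).IsBlossom e Y)
    (hfY : (S.head f).1 ∈ Y) : ∃ Z, S.IsTrail (S.head e) Z (S.head f) ∧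
      ∀ a ∈ Z, a ∈ (S.contract f X).arcs ∧ (S.contract f X).Inner Y a := by
  obtain ⟨Z, hZ, hZY⟩ := hY.exists_trail (S.head f) hfY
  have hpw : (e :: Z).Pairwise S.Apart := hY.pairwise_cons hZ.pairwise_apart hZY
  obtain rfl | ⟨Z, l, rfl⟩ := List.eq_nil_or_concat' Z
  · obtain rfl := hX.eq_of_contract_head_eq hZ.walk
    exact ⟨[], .nil, by simp⟩
  · obtain ⟨hl, hwalk, hlf⟩ := MultiDigraph.walk_concat.1 hZ.walk
    obtain rfl := hX.eq_of_contract_head_eq hlf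
    rw [contract_tail hX.tail_notMem] at hwalk
    have hZl := (List.pairwise_append.1 (List.cons_append ▸ hpw)).2.2
    have hwalk := hX.walk_of_contract hwalk hX.tail_notMem
      (fun hmem => (hZl _ hmem l (by simp)).1 rfl)
      fun hmem => (hZl _ (List.mem_cons_of_mem _ hmem) l (by simp)).2 rfl
    exact ⟨Z ++ [l], ⟨MultiDigraph.walk_concat.2 ⟨hl.1, hwalk, rfl⟩, hZ.pairwise_apart⟩,
      fun a ha => ⟨hZ.walk.mem_arcs a ha, hZY a ha⟩⟩

lemma of_contract (hX : S.IsBlossom f X) (hY : (S.contract f X).IsBlossom e Y) :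
    S.IsBlossom e (S.collapse f X ⁻¹' Y) := by
  have hinnerX {a : O} (hfY : (S.head f).1 ∈ Y) (ha : S.Inner X a) :
      S.Inner (S.collapse f X ⁻¹' Y) a := by
    simpa only [Inner, Set.mem_preimage, collapse_of_mem ha.1, collapse_of_mem ha.2, and_self]
  refine ⟨hY.mem.1, contract_tail_mem_iff.not.1 hY.tail_notMem,
    contract_head_mem_iff.1 hY.head_mem, fun p hp => ?_⟩
  by_cases hpX : p.1 ∈ X
  · rw [Set.mem_preimage, collapse_of_mem hpX] at hp
    obtain ⟨Z, hZ, hZY⟩ := hX.exists_trail_of_contract_of_mem hY hp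
    obtain ⟨W, hW, hWX⟩ := hX.exists_trail p hpX
    refine ⟨Z ++ W, hZ.append hW fun a ha b hb => ((hWX b hb).apart (hZY a ha).1.2).symm, ?_⟩
    exact List.forall_mem_append.2 ⟨fun a ha => contract_inner_iff.1 (hZY a ha).2,
      fun a ha => hinnerX hp (hWX a ha)⟩
  · rw [Set.mem_preimage, collapse_of_notMem hpX] at hp
    obtain ⟨Z, hZ, hZY⟩ := hY.exists_trail p hp
    obtain ⟨M, hM, hMpw, hMZ⟩ := hX.exists_lift hZ.walk hY.mem.2
      (hY.pairwise_cons hZ.pairwise_apart hZY) hpX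
    refine ⟨M, ⟨hM, hMpw.of_cons⟩, fun a ha => ?_⟩
    obtain haZ | ⟨haX, b, hb, hbX⟩ := hMZ a ha
    · exact contract_inner_iff.1 (hZY a haZ)
    · refine hinnerX ?_ haX
      rw [← collapse_of_mem hbX]
      exact (contract_inner_iff.1 (hZY b hb)).1

end IsBlossom

/-- A blob of a set `A` of arcs: a blossom that is entered by a single arc of `A`, and which may be
left by every arc of `A` except the reverse of its entry. -/
structure IsBlob (S : SkewDigraph O V) (A : Set O) (e : O) (X : Set V) : Prop
    extends S.IsBlossom e X where
  entry_mem : e ∈ A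
  eq_entry : ∀ a ∈ A, (S.head a).1 ∈ X → a = e
  mem_of_exit : ∀ a ∈ S.arcs, (S.tail a).1 ∈ X → (S.head a).1 ∉ X → a ≠ S.rev e → a ∈ A

/-- A barrier for the trails that start at the root `r`: a set `A` of arcs together with a partition
of the vertices into blobs and singletons, given by the class map `c` and the set `blobs` of the
values that it takes on the blobs. The trails from `r` only use arcs in `A` and arcs inside blobs;
conversely, the trails of arcs in `A` in the quotient lift to trails. -/
structure IsBarrier (S : SkewDigraph O V) (r : V) (c : V → V) (blobs : Set V) (A : Set O) :
    Prop where
  subset : A ⊆ S.arcs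
  rev_notMem : ∀ a ∈ A, S.rev a ∉ A
  head_ne_root : ∀ a ∈ A, (S.head a).1 ≠ r
  mem_of_tail_root : ∀ a ∈ S.arcs, (S.tail a).1 = r → a ∈ A
  root_notMem : c r ∉ blobs
  inj : ∀ u v, c u = c v → c u ∉ blobs → u = v
  mem_of_tail_eq_head : ∀ a ∈ A, c (S.head a).1 ∉ blobs →
    ∀ b ∈ S.arcs, S.tail b = S.head a → b ∈ A
  tail_eq_head : ∀ a ∈ A, ∀ b ∈ A, (S.tail b).1 = (S.head a).1 → c (S.head a).1 ∉ blobs →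
    S.tail b = S.head a
  exists_isBlob : ∀ y ∈ blobs, ∃ e, S.IsBlob A e (c ⁻¹' {y})

lemma IsBlob.of_contract (hX : S.IsBlossom f X) (hY : (S.contract f X).IsBlob A e Y) :
    S.IsBlob A e (S.collapse f X ⁻¹' Y) where
  toIsBlossom := hX.of_contract hY.toIsBlossom
  entry_mem := hY.entry_mem
  eq_entry a ha haY := hY.eq_entry a ha (contract_head_mem_iff.2 haY)
  mem_of_exit a ha htail hhead := by
    refine hY.mem_of_exit a ⟨ha, fun haX => hhead ?_⟩ (contract_tail_mem_iff.2 htail)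
      (contract_head_mem_iff.not.2 hhead)
    rwa [Set.mem_preimage, collapse_of_mem haX.2, ← collapse_of_mem haX.1]

/-- The arcs that end some walk from `r`. -/
def walkArcs (S : SkewDigraph O V) (r : V) : Set O :=
  {a | ∃ p L, p.1 = r ∧ S.Walk p (L ++ [a]) (S.head a)}

lemma mem_walkArcs_of_tail_eq_head (ha : a ∈ S.walkArcs r) (hb : b ∈ S.arcs)
    (hba : S.tail b = S.head a) : b ∈ S.walkArcs r := by
  obtain ⟨p, L, hp, hL⟩ := ha
  exact ⟨p, L ++ [a], hp, MultiDigraph.walk_concat.2 ⟨hb, hba ▸ hL, rfl⟩⟩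

lemma head_ne_of_mem_walkArcs (hr : ∀ L, ¬ S.IsClosedWalk r L) (ha : a ∈ S.walkArcs r) :
    (S.head a).1 ≠ r := by
  obtain ⟨p, L, hp, hL⟩ := ha
  exact fun har => hr (L ++ [a]) ⟨by simp, p, _, hL, hp, har⟩

lemma rev_notMem_walkArcs (hr : ∀ L, ¬ S.IsClosedWalk r L) (ha : a ∈ S.walkArcs r) :
    S.rev a ∉ S.walkArcs r := by
  rintro ⟨q, M, hq, hM⟩
  obtain ⟨p, L, hp, hL⟩ := ha
  obtain ⟨-, hM, -⟩ := MultiDigraph.walk_concat.1 hM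
  have hback := walk_revList hM
  rw [tail_rev, SignedVertex.opp_opp] at hback
  exact hr (L ++ [a] ++ S.revList M) ⟨by simp, p, q.opp, hL.append hback, hp, hq⟩

lemma notMem_of_collapse_notMem
    (hv : c (S.collapse f X v) ∉ insert (c (S.head f).1) blobs) : v ∉ X ∧ c v ∉ blobs := by
  have hvX : v ∉ X := fun hvX => hv (.inl (congrArg c (collapse_of_mem hvX)))
  rw [collapse_of_notMem hvX] at hv
  exact ⟨hvX, fun h => hv (.inr h)⟩

namespace IsBarrier

-- If the reverse of its entry were used to leave a blob, then the trail would have entered the blob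
-- by another arc, but there is no such arc.
theorem mem_or_inner (hB : S.IsBarrier r c blobs A) (h : S.IsTrail p L q) (hp : p.1 = r) :
    ∀ a ∈ L, a ∈ A ∨ ∃ y ∈ blobs, S.Inner (c ⁻¹' {y}) a := by
  induction L using List.reverseRecOn generalizing q with
  | nil => simp
  | append_singleton L b ih =>
    obtain ⟨hL, hb⟩ := h.split_at
    have hbS := hb.walk.1
    replace ih := ih hL
    refine List.forall_mem_append.2 ⟨ih, List.forall_mem_singleton.2 ?_⟩
    by_cases hy : c (S.tail b).1 ∈ blobs
    · obtain ⟨e, he⟩ := hB.exists_isBlob _ hy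
      refine or_iff_not_imp_right.2 fun hinner => he.mem_of_exit b hbS rfl
        (fun hhead => hinner ⟨_, hy, rfl, hhead⟩) ?_
      rintro rfl
      obtain ⟨a, haL, -, htail, hhead⟩ := hL.walk.exists_mem_inCut
        (X := Prod.fst ⁻¹' (c ⁻¹' {c (S.tail (S.rev e)).1}))
        (fun hpX => hB.root_notMem (by rw [← hp]; exact hpX ▸ hy)) rfl
      have haA : a ∈ A := (ih a haL).resolve_right fun ⟨z, _, hz⟩ =>
        htail (hz.1.trans (hz.2.symm.trans hhead))
      obtain rfl := he.eq_entry a haA hhead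
      exact ((List.pairwise_append.1 h.pairwise_apart).2.2 _ haL _ List.mem_cons_self).2
        (S.rev_rev _).symm
    · obtain rfl | ⟨K, a, rfl⟩ := List.eq_nil_or_concat' L
      · exact .inl (hB.mem_of_tail_root b hbS (hL.walk ▸ hp))
      · have hab := (MultiDigraph.walk_concat.1 hL.walk).2.2
        rcases ih a (by simp) with ha | ⟨y, hyB, hinner⟩
        · exact .inl (hB.mem_of_tail_eq_head a ha (hab ▸ hy) b hbS hab.symm)
        · refine absurd ?_ hy
          rw [← hab, hinner.2]
          exact hyB

lemma of_forall_not_isClosedWalk (hr : ∀ L, ¬ S.IsClosedWalk r L) :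
    S.IsBarrier r id ∅ (S.walkArcs r) where
  subset := fun _ ⟨_, _, _, h⟩ => h.mem_arcs _ (by simp)
  rev_notMem _ := rev_notMem_walkArcs hr
  head_ne_root _ := head_ne_of_mem_walkArcs hr
  mem_of_tail_root a ha har := ⟨_, [], har, ha, rfl, rfl⟩
  root_notMem := Set.notMem_empty _
  inj _ _ h _ := h
  mem_of_tail_eq_head _ ha _ _ := mem_walkArcs_of_tail_eq_head ha
  tail_eq_head a ha b hb hab _ := by
    refine (SignedVertex.eq_or_eq_opp hab).resolve_right fun hopp => ?_
    obtain ⟨p, L, hp, hL⟩ := hb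
    obtain ⟨-, hL, -⟩ := MultiDigraph.walk_concat.1 hL
    obtain rfl | ⟨L, b', rfl⟩ := List.eq_nil_or_concat' L
    · rw [MultiDigraph.walk_nil.1 hL, hab] at hp
      exact head_ne_of_mem_walkArcs hr ha hp
    · obtain ⟨hb'S, -, hb'⟩ := MultiDigraph.walk_concat.1 hL
      have hb'A : b' ∈ S.walkArcs r := ⟨p, L, hp, hb' ▸ hL⟩
      refine rev_notMem_walkArcs hr hb'A (mem_walkArcs_of_tail_eq_head ha (S.rev_mem _ hb'S) ?_)
      rw [tail_rev, hb', hopp, SignedVertex.opp_opp]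
  exists_isBlob y hy := absurd hy (Set.notMem_empty y)

lemma isBlob_of_contract (hX : S.IsBlossom f X) (hB : (S.contract f X).IsBarrier r c blobs A)
    (hf : f ∈ A) (hfc : c (S.head f).1 ∉ blobs) : S.IsBlob A f X where
  toIsBlossom := hX
  entry_mem := hf
  eq_entry a ha haX := by
    by_contra hne
    refine hB.rev_notMem f hf (hB.mem_of_tail_eq_head a ha ?_ (S.rev f)
      ((S.contract f X).rev_mem f (hB.subset hf)) ?_)
    · rwa [contract_head_fst, collapse_of_mem haX]
    · simp [contract, haX, hX.head_mem, hne]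
  mem_of_exit a ha htail hhead hne := by
    refine hB.mem_of_tail_eq_head f hf ?_ a ⟨ha, fun h => hhead h.2⟩ ?_
    · rwa [contract_head_fst, collapse_of_mem hX.head_mem]
    · simp [contract, htail, hX.head_mem, hne]

lemma preimage_comp_collapse (hX : S.IsBlossom f X) (hB : (S.contract f X).IsBarrier r c blobs A)
    (hfc : c (S.head f).1 ∉ blobs) : (c ∘ S.collapse f X) ⁻¹' {c (S.head f).1} = X := by
  ext v
  refine ⟨fun hv => ?_, fun hv => congrArg c (collapse_of_mem hv)⟩
  rw [← collapse_mem_iff hX.head_mem, ← hB.inj _ _ (Eq.symm hv) hfc]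
  exact hX.head_mem

lemma of_contract (hX : S.IsBlossom f X) (hrX : r ∉ X)
    (hB : (S.contract f X).IsBarrier r c blobs A) (hf : f ∈ A ∨ c (S.head f).1 ∈ blobs) :
    S.IsBarrier r (c ∘ S.collapse f X) (insert (c (S.head f).1) blobs) A := by
  refine ⟨fun a ha => (hB.subset ha).1, hB.rev_notMem, fun a ha h => hB.head_ne_root a ha ?_,
    fun a ha h => hB.mem_of_tail_root a ⟨ha, fun haX => hrX (h ▸ haX.1)⟩ ?_, ?_, ?_, ?_, ?_, ?_⟩
  · rwa [contract_head (h ▸ hrX)]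
  · rwa [contract_tail (h ▸ hrX)]
  · rw [Function.comp_apply, collapse_of_notMem hrX]
    refine fun h => h.elim (fun hrf => ?_) hB.root_notMem
    exact hrX (hB.inj r _ hrf hB.root_notMem ▸ hX.head_mem)
  · intro u v huv hu
    obtain ⟨huX, hub⟩ := notMem_of_collapse_notMem hu
    obtain ⟨hvX, -⟩ := notMem_of_collapse_notMem (huv ▸ hu)
    refine hB.inj u v ?_ hub
    simpa only [Function.comp_apply, collapse_of_notMem huX, collapse_of_notMem hvX] using huv
  · intro a ha h b hb hba
    obtain ⟨haX, hab⟩ := notMem_of_collapse_notMem h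
    have hbX : (S.tail b).1 ∉ X := hba ▸ haX
    refine hB.mem_of_tail_eq_head a ha ?_ b ⟨hb, fun hbX' => hbX hbX'.1⟩ ?_
    · rwa [contract_head haX]
    · rw [contract_head haX, contract_tail hbX, hba]
  · intro a ha b hb hba h
    obtain ⟨haX, hab⟩ := notMem_of_collapse_notMem h
    have hbX : (S.tail b).1 ∉ X := hba ▸ haX
    have := hB.tail_eq_head a ha b hb
    rw [contract_head haX, contract_tail hbX] at this
    exact this hba hab
  · intro y hy
    by_cases hyb : y ∈ blobs
    · obtain ⟨e, he⟩ := hB.exists_isBlob y hyb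
      exact ⟨e, he.of_contract hX⟩
    · obtain rfl := hy.resolve_right hyb
      refine ⟨f, ?_⟩
      rw [hB.preimage_comp_collapse hX hyb]
      exact hB.isBlob_of_contract hX (hf.resolve_right hyb) hyb

end IsBarrier

theorem exists_isBarrier (hfin : S.arcs.Finite)
    (hr : ∀ L, S.IsClosedWalk r L → ¬ L.Pairwise S.Apart) :
    ∃ c blobs A, S.IsBarrier r c blobs A := by
  induction hn : S.arcs.ncard using Nat.strong_induction_on generalizing S with
  | _ n ih =>
    subst hn
    by_cases hw : ∃ L, S.IsClosedWalk r L
    · obtain ⟨L, hL⟩ := hw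
      obtain ⟨f, X, P, p, hX, hp, hP, hPX⟩ := exists_isBlossom hr hL
      obtain ⟨b, hb, hbX⟩ := hX.exists_inner
      obtain ⟨hPX, -⟩ := List.forall_mem_append.1 hPX
      have hrX : r ∉ X := by
        cases P with
        | nil => exact hp ▸ hP.walk.2.1 ▸ hX.tail_notMem
        | cons a P => exact hp ▸ hP.walk.2.1 ▸ hPX a List.mem_cons_self
      have hsub : (S.contract f X).arcs ⊆ S.arcs := fun a (ha : a ∈ S.arcs ∧ _) => ha.1
      have hlt : (S.contract f X).arcs.ncard < S.arcs.ncard :=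
        Set.ncard_lt_ncard ⟨hsub, fun h => (h hb).2 hbX⟩ hfin
      obtain ⟨c, blobs, A, hB⟩ := ih _ hlt (hfin.subset hsub)
        (fun L (hL : (S.contract f X).IsClosedWalk r L) => hX.not_pairwise_contract hrX hr hL) rfl
      refine ⟨_, _, _, hB.of_contract hX hrX ?_⟩
      refine (hB.mem_or_inner (hX.isTrail_contract hP hPX) hp f (by simp)).imp_right ?_
      rintro ⟨y, hy, hyf⟩
      have hcf : c ((S.contract f X).head f).1 = y := hyf.2
      rw [contract_head_fst, collapse_of_mem hX.head_mem] at hcf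
      exact hcf ▸ hy
    · exact ⟨_, _, _, IsBarrier.of_forall_not_isClosedWalk fun L hL => hw ⟨L, hL⟩⟩

/-! ### Lifting walks of the quotient -/

variable {i j : O} {x y : V}

/-- The digraph of the arcs in `A` between the classes of a map `c` on the vertices. -/
def quotient (S : SkewDigraph O V) (c : V → V) (A : Set O) : MultiDigraph O V where
  tail a := c (S.tail a).1
  head a := c (S.head a).1
  arcs := A

/-- The arcs that a lift of a walk in the quotient may use on its way from the start of the arc `a`
to the start of the next arc: `a` itself and, if `a` enters a blob, the arcs inside that blob. -/
def segment (S : SkewDigraph O V) (c : V → V) (blobs : Set V) (a : O) : Set O :=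
  {i | i = a ∨ c (S.head a).1 ∈ blobs ∧ S.Inner (c ⁻¹' {c (S.head a).1}) i}

namespace IsBarrier

lemma not_inner (hB : S.IsBarrier r c blobs A) (ha : a ∈ A) (hy : y ∈ blobs) :
    ¬ S.Inner (c ⁻¹' {y}) a := fun h => by
  obtain ⟨e, he⟩ := hB.exists_isBlob y hy
  exact he.tail_notMem (he.eq_entry a ha h.2 ▸ h.1)

lemma apart_of_mem_segment (hB : S.IsBarrier r c blobs A) (ha : a ∈ A) (hb : b ∈ A) (hab : a ≠ b)
    (hi : i ∈ S.segment c blobs a) (hj : j ∈ S.segment c blobs b) : S.Apart i j := by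
  obtain rfl | ⟨haB, hi⟩ := hi <;> obtain rfl | ⟨hbB, hj⟩ := hj
  · exact ⟨hab, fun h => hB.rev_notMem j hb (h ▸ ha)⟩
  · exact (hj.apart (hB.not_inner ha hbB)).symm
  · exact hi.apart (hB.not_inner hb haB)
  · refine hi.apart fun hj' => hab ?_
    obtain ⟨e, he⟩ := hB.exists_isBlob _ haB
    have hbe : c (S.head b).1 = c (S.head a).1 := hj.1.symm.trans hj'.1
    rw [he.eq_entry a ha rfl, he.eq_entry b hb hbe]

lemma exists_trail_in_segment (hB : S.IsBarrier r c blobs A) (ha : a ∈ A)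
    (hq : c q.1 = c (S.head a).1) (hqa : c (S.head a).1 ∉ blobs → q = S.head a) :
    ∃ Z, S.IsTrail (S.tail a) (a :: Z) q ∧ ∀ i ∈ a :: Z, i ∈ S.segment c blobs a := by
  by_cases haB : c (S.head a).1 ∈ blobs
  · obtain ⟨e, he⟩ := hB.exists_isBlob _ haB
    obtain rfl := he.eq_entry a ha rfl
    obtain ⟨Z, hZ, hZa⟩ := he.exists_trail q hq
    exact ⟨Z, ⟨⟨he.mem, rfl, hZ.walk⟩, he.pairwise_cons hZ.pairwise_apart hZa⟩,
      List.forall_mem_cons.2 ⟨.inl rfl, fun i hi => .inr ⟨haB, hZa i hi⟩⟩⟩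
  · obtain rfl := hqa haB
    exact ⟨[], ⟨⟨hB.subset ha, rfl, rfl⟩, List.pairwise_singleton _ _⟩,
      List.forall_mem_singleton.2 (.inl rfl)⟩

lemma exists_lift_cons (hB : S.IsBarrier r c blobs A) (ha : a ∈ A)
    (hP : (S.quotient c A).Walk (c (S.head a).1) P (c x)) (hnd : (a :: P).Nodup) :
    ∃ L q, q.1 = x ∧ S.IsTrail (S.tail a) (a :: L) q ∧
      ∀ i ∈ a :: L, ∃ b ∈ a :: P, i ∈ S.segment c blobs b := by
  induction P generalizing a with
  | nil =>
    obtain ⟨q, rfl, hqa⟩ : ∃ q : SignedVertex V, q.1 = x ∧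
        (c (S.head a).1 ∉ blobs → q = S.head a) := by
      by_cases haB : c (S.head a).1 ∈ blobs
      · exact ⟨(x, 1), rfl, fun h => absurd haB h⟩
      · exact ⟨S.head a, hB.inj _ _ hP haB, fun _ => rfl⟩
    obtain ⟨Z, hZ, hZa⟩ := hB.exists_trail_in_segment ha (Eq.symm hP) hqa
    exact ⟨Z, q, rfl, hZ, fun i hi => ⟨a, by simp, hZa i hi⟩⟩
  | cons b P ih =>
    obtain ⟨hb, hba, hP⟩ := hP
    obtain ⟨L, q, hq, hL, hLP⟩ := ih hb hP hnd.of_cons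
    obtain ⟨Z, hZ, hZa⟩ := hB.exists_trail_in_segment (q := S.tail b) ha hba fun haB =>
      hB.tail_eq_head a ha b hb (hB.inj _ _ (Eq.symm hba) haB).symm haB
    refine ⟨Z ++ b :: L, q, hq, hZ.append hL fun i hi j hj => ?_, ?_⟩
    · obtain ⟨d, hd, hjd⟩ := hLP j hj
      have hdA : d ∈ A := (List.mem_cons.1 hd).elim (· ▸ hb) (hP.mem_arcs d)
      have had : a ≠ d := fun had => (List.nodup_cons.1 hnd).1 (had ▸ hd)
      exact hB.apart_of_mem_segment ha hdA had (hZa i hi) hjd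
    · rw [← List.cons_append, List.forall_mem_append]
      exact ⟨fun i hi => ⟨a, by simp, hZa i hi⟩, fun i hi => (hLP i hi).imp fun d hd =>
        ⟨List.mem_cons_of_mem _ hd.1, hd.2⟩⟩

lemma exists_lift (hB : S.IsBarrier r c blobs A) (hrx : r ≠ x)
    (hP : (S.quotient c A).Walk (c r) P (c x)) (hnd : P.Nodup) :
    ∃ L p q, p.1 = r ∧ q.1 = x ∧ S.IsTrail p L q ∧ ∀ i ∈ L, ∃ b ∈ P, i ∈ S.segment c blobs b := by
  cases P with
  | nil => exact absurd (hB.inj r x hP hB.root_notMem) hrx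
  | cons a P =>
    obtain ⟨ha, har, hP⟩ := hP
    obtain ⟨L, q, hq, hL, hLP⟩ := hB.exists_lift_cons ha hP hnd
    exact ⟨a :: L, _, q, (hB.inj r _ (Eq.symm har) hB.root_notMem).symm, hq, hL, hLP⟩

end IsBarrier

/-- The arcs that end some trail from `r`. -/
def trailArcs (S : SkewDigraph O V) (r : V) : Set O :=
  {a | ∃ p L, p.1 = r ∧ S.IsTrail p (L ++ [a]) (S.head a)}

-- The cut is a minimum cut of the quotient: a trail cannot enter it inside a blob.
theorem exists_apart_trails_and_cut (hfin : S.arcs.Finite)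
    (hr : ∀ L, S.IsClosedWalk r L → ¬ L.Pairwise S.Apart) (hrx : r ≠ x) :
    ∃ (n : ℕ) (T : Fin n → List O) (X : Set V),
      (∀ k, ∃ p q, p.1 = r ∧ q.1 = x ∧ S.IsTrail p (T k) q) ∧
      (Pairwise fun k l => ∀ i ∈ T k, ∀ j ∈ T l, S.Apart i j) ∧ x ∈ X ∧ r ∉ X ∧
      {a ∈ S.trailArcs r | (S.tail a).1 ∉ X ∧ (S.head a).1 ∈ X}.encard ≤ n := by
  obtain ⟨c, blobs, A, hB⟩ := exists_isBarrier hfin hr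
  have hcrx : c r ≠ c x := fun h => hrx (hB.inj r x h hB.root_notMem)
  obtain ⟨n, P, Y, hP, hdisj, hx, hrY, hcard⟩ :=
    (S.quotient c A).exists_disjoint_walks_and_cut (hfin.subset hB.subset) hcrx
  choose T p q hp hq hT hTP using fun k => hB.exists_lift hrx (hP k).1 (hP k).2
  refine ⟨n, T, c ⁻¹' Y, fun k => ⟨p k, q k, hp k, hq k, hT k⟩, fun k l hkl i hi j hj => ?_, hx,
    hrY, (Set.encard_le_encard ?_).trans hcard.le⟩
  · obtain ⟨a, ha, hia⟩ := hTP k i hi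
    obtain ⟨b, hb, hjb⟩ := hTP l j hj
    refine hB.apart_of_mem_segment ((hP k).1.mem_arcs a ha) ((hP l).1.mem_arcs b hb) ?_ hia hjb
    rintro rfl
    exact hdisj hkl ha hb
  · rintro a ⟨⟨p, L, hp, hL⟩, htail, hhead⟩
    refine ⟨(hB.mem_or_inner hL hp a (by simp)).resolve_right ?_, htail, hhead⟩
    rintro ⟨y, -, hya, hya'⟩
    exact htail (show c _ ∈ Y from (hya.trans (Eq.symm hya')) ▸ hhead)

end SkewDigraph

/-! ### Trails of bidirected graphs -/

namespace BidirectedGraph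

variable {α β : Type*} {B : BidirectedGraph α β} {r x : α} {X : Set α} {G : Set β}
  {p q : SignedVertex α} {o o' : B.OrientedEdge} {K L : List B.OrientedEdge} {T : B.Trail}
  {𝒯 : Set B.Trail}

namespace OrientedEdge

/-- The opposite orientation of an oriented edge. -/
def reverse (o : B.OrientedEdge) : B.OrientedEdge :=
  ⟨o.edge, o.head, o.tail, o.isLink.symm⟩

lemma reverse_ne (o : B.OrientedEdge) : o.reverse ≠ o := fun h => by
  have := B.loopless
  exact o.isLink.ne (congrArg OrientedEdge.head h)

lemma edge_eq_iff : o.edge = o'.edge ↔ o = o' ∨ o = o'.reverse := by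
  refine ⟨fun h => ?_, ?_⟩
  · rcases (h ▸ o.isLink).eq_and_eq_or_eq_and_eq o'.isLink with ⟨ht, hh⟩ | ⟨ht, hh⟩
    · exact .inl (OrientedEdge.ext h ht hh)
    · exact .inr (OrientedEdge.ext h ht hh)
  · rintro (rfl | rfl) <;> rfl

end OrientedEdge

/-- The skew-symmetric digraph whose arcs are the orientations of the edges in `G`. The sign at the
tail of an arc is negated, so that consecutive arcs of a walk have opposite signs at the vertex
between them. -/
def skewDigraph (B : BidirectedGraph α β) (G : Set β) : SkewDigraph B.OrientedEdge α where
  tail o := (o.tail, -o.tailSign)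
  head o := (o.head, o.headSign)
  arcs := {o | o.edge ∈ G}
  rev := OrientedEdge.reverse
  rev_rev _ := rfl
  tail_rev _ := rfl
  rev_mem _ h := h

lemma apart_skewDigraph_iff : (B.skewDigraph G).Apart o o' ↔ o.edge ≠ o'.edge := by
  rw [ne_eq, OrientedEdge.edge_eq_iff, not_or]
  rfl

lemma tail_skewDigraph_eq_head_iff : (B.skewDigraph G).tail o' = (B.skewDigraph G).head o ↔
    o'.tail = o.head ∧ o'.tailSign = -o.headSign := by
  simp [skewDigraph, neg_eq_iff_eq_neg]

lemma walk_skewDigraph_cons_iff : (B.skewDigraph G).Walk p (o :: L) q ↔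
    (∀ a ∈ o :: L, a.edge ∈ G) ∧ (B.skewDigraph G).tail o = p ∧
      (o :: L).IsChain (fun e f => f.tail = e.head ∧ f.tailSign = -e.headSign) ∧
      (B.skewDigraph G).head ((o :: L).getLast (List.cons_ne_nil o L)) = q := by
  induction L generalizing o p with
  | nil => simp [skewDigraph]
  | cons a L ih =>
    rw [MultiDigraph.walk_cons, ih, tail_skewDigraph_eq_head_iff, List.forall_mem_cons (a := o),
      List.isChain_cons_cons, List.getLast_cons_cons]
    simp only [skewDigraph, Set.mem_ofPred_eq]
    tauto

lemma finite_arcs_skewDigraph (hG : G.Finite) : (B.skewDigraph G).arcs.Finite := by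
  refine Set.Finite.of_finite_fibers OrientedEdge.edge (hG.subset ?_) fun e _ => ?_
  · rintro _ ⟨o, ho, rfl⟩
    exact ho
  · obtain hempty | ⟨o, -, rfl⟩ := Set.eq_empty_or_nonempty
      ((B.skewDigraph G).arcs ∩ OrientedEdge.edge ⁻¹' {e})
    · exact hempty ▸ Set.finite_empty
    · exact (Set.toFinite {o, o.reverse}).subset fun a ha => OrientedEdge.edge_eq_iff.1 ha.2

namespace Trail

lemma exists_isTrail (T : B.Trail) (hG : T.edgeSet ⊆ G) :
    ∃ p q, p.1 = T.init ∧ q.1 = T.term ∧ (B.skewDigraph G).IsTrail p T.edges q := by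
  have hapart : T.edges.Pairwise (B.skewDigraph G).Apart :=
    (List.pairwise_map.1 T.nodup).imp apart_skewDigraph_iff.2
  obtain ⟨init, init_mem, _ | ⟨o, L⟩, tail_first, chain, nodup⟩ := T
  · exact ⟨(init, 1), (init, 1), rfl, rfl, rfl, .nil⟩
  · refine ⟨_, _, tail_first o rfl, ?_, walk_skewDigraph_cons_iff.2
      ⟨fun a ha => hG ⟨a, ha, rfl⟩, rfl, chain, rfl⟩, hapart⟩
    simp [term, skewDigraph, List.getLast?_eq_some_getLast]

lemma exists_of_isTrail (h : (B.skewDigraph G).IsTrail p L q) (hp : p.1 ∈ B.graph.vertexSet) :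
    ∃ T : B.Trail, T.edges = L ∧ T.IsFromTo p.1 q.1 := by
  have hnodup : (L.map OrientedEdge.edge).Nodup :=
    List.pairwise_map.2 (h.pairwise_apart.imp apart_skewDigraph_iff.1)
  cases L with
  | nil => exact ⟨⟨p.1, hp, [], by simp, .nil, hnodup⟩, rfl, rfl, congrArg Prod.fst h.walk⟩
  | cons o L =>
    obtain ⟨-, rfl, hchain, rfl⟩ := walk_skewDigraph_cons_iff.1 h.walk
    refine ⟨⟨_, hp, o :: L, by simp [skewDigraph], hchain, hnodup⟩, rfl, rfl, ?_⟩
    simp [term, skewDigraph, List.getLast?_eq_some_getLast]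

lemma exists_prefix (T : B.Trail) (hK : K <+: T.edges) :
    ∃ T' : B.Trail, T'.init = T.init ∧ T'.edges = K :=
  ⟨⟨T.init, T.init_mem, K, fun e he => T.tail_first e <|
    List.singleton_prefix_iff_head?_eq_some.1
      ((List.singleton_prefix_iff_head?_eq_some.2 he).trans hK),
    T.chain.prefix hK, T.nodup.sublist (hK.sublist.map _)⟩, rfl, rfl⟩

lemma exists_mem_edges_entering (hinit : T.init ∉ X) (hterm : T.term ∈ X) :
    ∃ o ∈ T.edges, o.tail ∉ X ∧ o.head ∈ X := by
  obtain ⟨p, q, hp, hq, hT⟩ := T.exists_isTrail (Set.subset_univ _)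
  obtain ⟨o, ho, -, htail, hhead⟩ :=
    hT.walk.exists_mem_inCut (X := Prod.fst ⁻¹' X) (by simpa [hp]) (by simpa [hq])
  exact ⟨o, ho, htail, hhead⟩

lemma IsFromTo.edgeSet_nonempty (hT : T.IsFromTo r x) (hxr : x ≠ r) : T.edgeSet.Nonempty := by
  obtain ⟨init, init_mem, _ | ⟨o, L⟩, tail_first, chain, nodup⟩ := T
  · exact absurd (hT.2.symm.trans hT.1) hxr
  · exact ⟨o.edge, o, List.mem_cons_self, rfl⟩

lemma finite_edgeSet (T : B.Trail) : T.edgeSet.Finite :=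
  (List.finite_toSet T.edges).image OrientedEdge.edge

end Trail

lemma trailReaches_of_tail_eq (ho : o.tail = r) : B.TrailReaches r o :=
  ⟨⟨o.tail, o.isLink.left_mem, [o], by simp, by simp, by simp⟩, ⟨ho, by simp⟩, rfl⟩

lemma TrailReaches.exists_finite_mem_trailArcs (ho : B.TrailReaches r o) :
    ∃ E : Set β, E.Finite ∧ ∀ G, E ⊆ G → o ∈ (B.skewDigraph G).trailArcs r := by
  obtain ⟨T, hT, ho⟩ := ho
  obtain ⟨L, hL⟩ := List.getLast?_eq_some_iff.1 ho
  refine ⟨T.edgeSet, T.finite_edgeSet, fun G hG => ?_⟩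
  obtain ⟨p, q, hp, -, hTG⟩ := T.exists_isTrail hG
  rw [hL] at hTG
  obtain rfl := (MultiDigraph.walk_concat.1 hTG.walk).2.2
  exact ⟨p, L, hp.trans hT.1, hTG⟩

namespace EdgeClean

-- The first edge with which a trail from `r` returns to `r` would be reached in this direction by
-- the trail, and in the other direction in one step.
lemma head_ne (hB : B.EdgeClean r) (hT : T.init = r) : ∀ o ∈ T.edges, o.head ≠ r := by
  classical
  by_contra! hreturn
  obtain ⟨o, ho⟩ : ∃ o, T.edges.find? (·.head = r) = some o :=
    Option.isSome_iff_exists.1 (List.find?_isSome.2 (by simpa using hreturn))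
  obtain ⟨hor, K, L, hKL, hK⟩ := List.find?_eq_some_iff_append.1 ho
  simp only [decide_eq_true_eq, Bool.not_eq_eq_eq_not, Bool.not_true, decide_eq_false_iff_not]
    at hor hK
  obtain ⟨T', hT', hedges⟩ := T.exists_prefix (K := K ++ [o]) ⟨L, by simp [hKL]⟩
  have hreach : B.TrailReaches r o :=
    ⟨T', ⟨hT'.trans hT, by simpa [hedges] using hK⟩, by simp [hedges]⟩
  have hreach' : B.TrailReaches r o.reverse := trailReaches_of_tail_eq hor
  obtain ⟨_, -, hunique⟩ := hB o.edge (hor ▸ o.isLink.inc_right)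
  exact o.reverse_ne ((hunique o.reverse ⟨rfl, hreach'⟩).trans (hunique o ⟨rfl, hreach⟩).symm)

lemma trailReaches (hB : B.EdgeClean r) (hT : T.init = r) (ho : o ∈ T.edges) :
    B.TrailReaches r o := by
  obtain ⟨K, L, hKL⟩ := List.append_of_mem ho
  obtain ⟨T', hT', hedges⟩ := T.exists_prefix (K := K ++ [o]) ⟨L, by simp [hKL]⟩
  refine ⟨T', ⟨hT'.trans hT, fun a ha => hB.head_ne hT a ?_⟩, by simp [hedges]⟩
  rw [hedges, List.dropLast_concat] at ha
  exact hKL ▸ List.mem_append_left _ ha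

lemma not_pairwise_apart (hB : B.EdgeClean r) (hr : r ∈ B.graph.vertexSet)
    (hL : (B.skewDigraph G).IsClosedWalk r L) : ¬ L.Pairwise (B.skewDigraph G).Apart := by
  intro hapart
  obtain ⟨hL₀, p, q, hw, hp, hq⟩ := hL
  obtain ⟨T, rfl, hT⟩ := Trail.exists_of_isTrail ⟨hw, hapart⟩ (hp ▸ hr)
  obtain ⟨K, o, hKo⟩ := (List.eq_nil_or_concat' T.edges).resolve_left hL₀
  refine hB.head_ne (hT.1.trans hp) o (by simp [hKo]) ?_
  rw [← hq, ← hT.2, Trail.term, hKo]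
  simp

end EdgeClean

namespace IsEdgeDisjointTrails

lemma encard_le (h𝒯 : B.IsEdgeDisjointTrails r x 𝒯) {E : Set β}
    (hE : ∀ T ∈ 𝒯, (T.edgeSet ∩ E).Nonempty) : 𝒯.encard ≤ E.encard := by
  choose e heT heE using fun T : 𝒯 => hE T T.2
  refine Function.Embedding.encard_le ⟨fun T => ⟨e T, heE T⟩, fun S T hST => ?_⟩
  by_contra hne
  have hdisj := h𝒯.2 S.2 T.2 (Subtype.coe_ne_coe.2 hne)
  have hST' : e S = e T := congrArg Subtype.val hST
  exact Set.disjoint_left.1 hdisj (heT S) (hST' ▸ heT T)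

lemma encard_le_encard_trailCut (h𝒯 : B.IsEdgeDisjointTrails r x 𝒯) (hB : B.EdgeClean r)
    (hr : r ∉ X) (hx : x ∈ X) : 𝒯.encard ≤ (B.trailCut r X).encard := by
  refine h𝒯.encard_le fun T hT => ?_
  obtain ⟨hinit, hterm⟩ := h𝒯.1 T hT
  obtain ⟨o, ho, htail, hhead⟩ :=
    Trail.exists_mem_edges_entering (hinit ▸ hr : T.init ∉ X) (hterm ▸ hx)
  exact ⟨o.edge, ⟨o, ho, rfl⟩, o, rfl, hhead, htail, hB.trailReaches hinit ho⟩

end IsEdgeDisjointTrails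

lemma exists_isEdgeDisjointTrails_meeting (hxr : x ≠ r) :
    ∃ 𝒯 : Set B.Trail, B.IsEdgeDisjointTrails r x 𝒯 ∧
      ∀ T : B.Trail, T.IsFromTo r x → (T.edgeSet ∩ ⋃ S ∈ 𝒯, S.edgeSet).Nonempty := by
  obtain ⟨𝒯, h𝒯⟩ := zorn_subset {𝒯 | B.IsEdgeDisjointTrails r x 𝒯} fun c hc hchain =>
    ⟨⋃₀ c, ⟨fun T ⟨s, hs, hT⟩ => (hc hs).1 T hT,
      (Set.pairwise_sUnion hchain.directedOn).2 fun s hs => (hc hs).2⟩,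
      fun s hs => Set.subset_sUnion_of_mem hs⟩
  refine ⟨𝒯, h𝒯.prop, fun T hT => ?_⟩
  by_contra hmeet
  have hdisj : ∀ S ∈ 𝒯, Disjoint T.edgeSet S.edgeSet := fun S hS =>
    (Set.disjoint_iff_inter_eq_empty.2 (Set.not_nonempty_iff_eq_empty.1 hmeet)).mono_right
      (Set.subset_biUnion_of_mem (u := Trail.edgeSet) hS)
  have hinsert : B.IsEdgeDisjointTrails r x (insert T 𝒯) :=
    ⟨Set.forall_mem_insert.2 ⟨hT, h𝒯.prop.1⟩,
      h𝒯.prop.2.insert fun S hS _ => ⟨hdisj S hS, (hdisj S hS).symm⟩⟩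
  have hT𝒯 : T ∈ 𝒯 := h𝒯.le_of_ge hinsert (Set.subset_insert _ _) (Set.mem_insert _ _)
  exact (hT.edgeSet_nonempty hxr).ne_empty (disjoint_self.1 (hdisj T hT𝒯))

lemma exists_encard_eq_top (hxr : x ≠ r)
    (h : ∀ n : ℕ, ∃ 𝒯, B.IsEdgeDisjointTrails r x 𝒯 ∧ n ≤ 𝒯.encard) :
    ∃ 𝒯, B.IsEdgeDisjointTrails r x 𝒯 ∧ 𝒯.encard = ⊤ := by
  obtain ⟨𝒯, h𝒯, hmeet⟩ := exists_isEdgeDisjointTrails_meeting (B := B) hxr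
  refine ⟨𝒯, h𝒯, ?_⟩
  by_contra hfin
  have hE : (⋃ S ∈ 𝒯, S.edgeSet).Finite :=
    (Set.encard_ne_top_iff.1 hfin).biUnion fun S _ => S.finite_edgeSet
  obtain ⟨𝒮, h𝒮, hcard⟩ := h ((⋃ S ∈ 𝒯, S.edgeSet).ncard + 1)
  have hle := hcard.trans (h𝒮.encard_le fun T hT => hmeet T (h𝒮.1 T hT))
  rw [← hE.cast_ncard_eq, Nat.cast_le] at hle
  omega

namespace EdgeClean

lemma exists_trails_and_cut_of_finite (hB : B.EdgeClean r) (hr : r ∈ B.graph.vertexSet)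
    (hx : x ∈ B.graph.vertexSet) (hxr : x ≠ r) (hG : G.Finite) :
    ∃ 𝒯 X, B.IsEdgeDisjointTrails r x 𝒯 ∧ X ⊆ B.graph.vertexSet \ {r} ∧ x ∈ X ∧
      {o ∈ (B.skewDigraph G).trailArcs r | o.tail ∉ X ∧ o.head ∈ X}.encard ≤ 𝒯.encard := by
  obtain ⟨n, L, X, hL, hapart, hxX, hrX, hcard⟩ :=
    SkewDigraph.exists_apart_trails_and_cut (finite_arcs_skewDigraph (B := B) hG)
      (fun L => hB.not_pairwise_apart hr) hxr.symm
  have htrail (k : Fin n) : ∃ T : B.Trail, T.edges = L k ∧ T.IsFromTo r x := by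
    obtain ⟨p, q, rfl, rfl, h⟩ := hL k
    exact Trail.exists_of_isTrail h hr
  choose T hTL hT using htrail
  have hdisj : Pairwise fun k l => Disjoint (T k).edgeSet (T l).edgeSet := by
    intro k l hkl
    rw [Set.disjoint_left]
    rintro _ ⟨o, ho, rfl⟩ ⟨o', ho', hoo'⟩
    exact apart_skewDigraph_iff.1 (hapart hkl o (hTL k ▸ ho) o' (hTL l ▸ ho')) hoo'.symm
  have hinj : Function.Injective T := fun k l hkl => by
    by_contra hne
    have hself : Disjoint (T k).edgeSet (T l).edgeSet := hdisj hne
    rw [hkl, disjoint_self] at hself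
    exact ((hT l).edgeSet_nonempty hxr).ne_empty hself
  refine ⟨Set.range T, X ∩ B.graph.vertexSet, ⟨Set.forall_mem_range.2 hT, ?_⟩,
    fun v hv => ⟨hv.2, fun hvr => hrX (hvr ▸ hv.1)⟩, ⟨hxX, hx⟩, ?_⟩
  · rintro _ ⟨k, rfl⟩ _ ⟨l, rfl⟩ hkl
    exact hdisj fun h => hkl (congrArg T h)
  · have hn : (n : ℕ∞) ≤ (Set.range T).encard := by simpa using hinj.encard_range
    refine (Set.encard_le_encard ?_).trans (hcard.trans hn)
    rintro o ⟨ho, htail, hhead⟩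
    exact ⟨ho, fun h => htail ⟨h, o.isLink.left_mem⟩, hhead.1⟩

-- A limit of the cuts for the finite edge sets along an ultrafilter: a given orientation enters the
-- limit if and only if it enters almost all of those cuts.
lemma exists_cut (hB : B.EdgeClean r) (hr : r ∈ B.graph.vertexSet) (hx : x ∈ B.graph.vertexSet)
    (hxr : x ≠ r) :
    ∃ X ⊆ B.graph.vertexSet \ {r}, x ∈ X ∧ ∀ D ⊆ B.trailCut r X, D.Finite →
      ∃ 𝒯, B.IsEdgeDisjointTrails r x 𝒯 ∧ D.encard ≤ 𝒯.encard := by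
  choose 𝒯 X h𝒯 hX hxX hcard using fun G : Finset β =>
    hB.exists_trails_and_cut_of_finite hr hx hxr G.finite_toSet
  let U : Ultrafilter (Finset β) := .of .atTop
  refine ⟨{v | ∀ᶠ G in U, v ∈ X G}, fun v hv => ?_, .of_forall hxX, fun D hD hDfin => ?_⟩
  · obtain ⟨G, hG⟩ := Filter.Eventually.exists hv
    exact hX G hG
  choose o hoe hhead htail hreach using fun e : D => hD e.2
  have hev : ∀ᶠ G : Finset β in U, ∀ e,
      o e ∈ (B.skewDigraph G).trailArcs r ∧ (o e).tail ∉ X G ∧ (o e).head ∈ X G := by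
    have := hDfin.to_subtype
    refine Filter.eventually_all.2 fun e => ?_
    obtain ⟨E, hE, hEo⟩ := (hreach e).exists_finite_mem_trailArcs
    have hEG : ∀ᶠ G : Finset β in U, E ⊆ G := Ultrafilter.of_le _
      ((Filter.eventually_ge_atTop hE.toFinset).mono fun G => hE.toFinset_subset.1)
    filter_upwards [hEG, Ultrafilter.eventually_not.2 (htail e), hhead e] with G hEG htail hhead
    exact ⟨hEo G hEG, htail, hhead⟩
  obtain ⟨G, hG⟩ := hev.exists
  refine ⟨𝒯 G, h𝒯 G, (Function.Embedding.encard_le ⟨fun e => ⟨o e, hG e⟩, ?_⟩).trans (hcard G)⟩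
  intro e e' h
  have ho : o e = o e' := congrArg Subtype.val h
  exact Subtype.ext (by rw [← hoe e, ho, hoe e'])

theorem exists_trails_and_cut (hB : B.EdgeClean r) (hr : r ∈ B.graph.vertexSet)
    (hx : x ∈ B.graph.vertexSet) (hxr : x ≠ r) :
    ∃ 𝒯 X, B.IsEdgeDisjointTrails r x 𝒯 ∧ X ⊆ B.graph.vertexSet \ {r} ∧ x ∈ X ∧
      (B.trailCut r X).encard ≤ 𝒯.encard := by
  obtain ⟨X, hX, hxX, htrails⟩ := hB.exists_cut hr hx hxr
  by_cases hfin : (B.trailCut r X).Finite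
  · obtain ⟨𝒯, h𝒯, hle⟩ := htrails _ subset_rfl hfin
    exact ⟨𝒯, X, h𝒯, hX, hxX, hle⟩
  · obtain ⟨𝒯, h𝒯, htop⟩ : ∃ 𝒯, B.IsEdgeDisjointTrails r x 𝒯 ∧ 𝒯.encard = ⊤ := by
      refine exists_encard_eq_top hxr fun n => ?_
      obtain ⟨D, hD, hDn⟩ := Set.exists_subset_encard_eq
        (le_top.trans_eq (Set.encard_eq_top_iff.2 hfin).symm : (n : ℕ∞) ≤ _)
      obtain ⟨𝒯, h𝒯, hle⟩ := htrails D hD (Set.finite_of_encard_eq_coe hDn)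
      exact ⟨𝒯, h𝒯, hDn ▸ hle⟩
    exact ⟨𝒯, X, h𝒯, hX, hxX, htop ▸ le_top⟩

end EdgeClean

end BidirectedGraph

theorem mainTheorem2 {α β : Type*} (B : BidirectedGraph α β) (r x : α)
    (hr : r ∈ B.graph.vertexSet) (hx : x ∈ B.graph.vertexSet) (hxr : x ≠ r)
    (hB : B.EdgeClean r) :
    ∃ n : ℕ∞,
      IsGreatest {k : ℕ∞ | ∃ 𝒯 : Set B.Trail, B.IsEdgeDisjointTrails r x 𝒯 ∧ 𝒯.encard = k} n ∧
      IsLeast {k : ℕ∞ | ∃ X : Set α, X ⊆ B.graph.vertexSet \ {r} ∧ x ∈ X ∧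
        (B.trailCut r X).encard = k} n := by
  obtain ⟨𝒯, X, h𝒯, hX, hxX, hle⟩ := hB.exists_trails_and_cut hr hx hxr
  have hweak : ∀ 𝒮, B.IsEdgeDisjointTrails r x 𝒮 → ∀ Y ⊆ B.graph.vertexSet \ {r}, x ∈ Y →
      𝒮.encard ≤ (B.trailCut r Y).encard := fun 𝒮 h𝒮 Y hY hxY =>
    h𝒮.encard_le_encard_trailCut hB (fun hrY => (hY hrY).2 rfl) hxY
  refine ⟨𝒯.encard, ⟨⟨𝒯, h𝒯, rfl⟩, ?_⟩, ⟨X, hX, hxX, hle.antisymm (hweak 𝒯 h𝒯 X hX hxX)⟩, ?_⟩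
  · rintro _ ⟨𝒮, h𝒮, rfl⟩
    exact (hweak 𝒮 h𝒮 X hX hxX).trans hle
  · rintro _ ⟨Y, hY, hxY, rfl⟩
    exact hweak 𝒯 h𝒯 Y hY hxY
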